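/- Let $\mathbb{K}$ be a field that is either algebraically closed or isomorphic to a Novikov field $$\Lambda_{\Bbbk,Q}=\Big\{\sum_{j\ge 0} c_jT^{\lambda_j} : c_j\in\Bbbk,\ \lambda_j\in Q,\ \lambda_j\to+\infty\Big\}$$ for some field $\Bbbk$ and some subgroup $Q\subset\mathbb{R}$. Let $\mathrm{val}:\mathbb{K}\to\mathbb{R}\cup\{\infty\}$ be a non-Archimedean valuation such that $\mathrm{val}(m)=0$ for every integer $m$ whose image in $\mathbb{K}$ is non-zero. Let $M\cong\mathbb{Z}^n$ be a lattice with dual lattice $M^*$, and let $\Sigma^*$ be a smooth fan in $M$, that is, a fan each of whose cones is generated by part of a $\mathbb{Z}$-basis of $M$. Let $\Delta^*\subset M^*_{\mathbb{R}}$ be a lattice polytope such that every cone of $\Sigma^*$ is contained in a cone of the inner normal fan of $\Delta^*$. (If $\Sigma^*$ is complete, this holds in particular when the line bundle $\mathcal{L}_{\Delta^*}$ on the toric variety of $\Sigma^*$ is ample, in which case $\Sigma^*$ is the normal fan of $\Delta^*$. Completeness of $\Sigma^*$ is not required.) Put $\Xi=\Delta^*\cap M^*$. Let $Y^*_{\mathbb{K}}$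 be the toric variety of $\Sigma^*$ over $\mathbb{K}$. For $b\in\mathbb{K}^{\Xi}$ let $$X^*_b=\Big\{\sum_{\vec p\in\Xi}b_{\vec p}\,z^{\vec p}=0\Big\}\subset Y^*_{\mathbb{K}}$$ be the closed subscheme that is given, in the chart $\mathrm{Spec}\,\mathbb{K}[\sigma^\vee\cap M^*]$ of each $\sigma\in\Sigma^*$, by the equation $\sum_{\vec p\in\Xi} b_{\vec p}\,z^{\vec p-\vec p_0}=0$, where $\vec p_0\in\Xi$ is any lattice point of the face of $\Delta^*$ dual to $\sigma$, i.e. one with $\langle\vec p_0,u\rangle=\min_{\Delta^*}\langle\cdot,u\rangle$ for all $u\in\sigma$. Put $v(\vec p)=\mathrm{val}(b_{\vec p})$, and suppose that $v(\vec p)\ne\infty$ for every vertex $\vec p$ of $\Delta^*$. Let $\psi:\Delta^*\to\mathbb{R}$ be the smallest concave function with $\psi(\vec p)\ge -v(\vec p)$ for all $\vec p\in\Xi$; its domains of linearity (the maximal convex subsets of $\Delta^*$ on which $\psi$ is affine) are the maximal cells of the regular subdivision of $\Delta^*$ induced by $v$. Suppose that each of these cells is a simplex with vertices in $\Xi$ that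 contains no points of $\Xi$ other than its vertices, and whose normalized affine volume is not divisible by $\mathrm{char}\,\mathbb{K}$. Here the affine volume is normalized so that the smallest non-zero volume of a lattice simplex in the affine span is $1$; that is, the normalized volume of a lattice simplex with vertices $\vec q_0,\dots,\vec q_d$ is the index of $\langle\vec q_i-\vec q_0\rangle_{\mathbb{Z}}$ in $M^*\cap\mathrm{span}_{\mathbb{R}}(\vec q_i-\vec q_0)$. Then $X^*_b$ is smooth over $\mathbb{K}$. -/

import Mathlib

universe u

namespace TropicalRegularity

open CategoryTheory CategoryTheory.Limits AlgebraicGeometry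

noncomputable section

/-- The inclusion `ℤⁿ → ℝⁿ` of the lattice (`M`, or its dual `M*`) in its real span. -/
def latticeToReal (n : ℕ) : (Fin n → ℤ) →+ (Fin n → ℝ) := (Int.castAddHom ℝ).compLeft (Fin n)

/-- The pairing of `M*_ℝ = ℝⁿ` (first argument) with `M_ℝ = ℝⁿ` (second argument). -/
def pairing {n : ℕ} : (Fin n → ℝ) →ₗ[ℝ] (Fin n → ℝ) →ₗ[ℝ] ℝ := dotProductBilin ℝ ℝ

/-- `τ` is a face of the rational cone `σ ⊆ M_ℝ`: it is cut out of `σ` by the hyperplane `m^⊥` for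
a lattice point `m ∈ M*` that is nonnegative on `σ`. -/
def IsFace {n : ℕ} (τ σ : PointedCone ℝ (Fin n → ℝ)) : Prop :=
  ∃ m : Fin n → ℤ, (∀ u ∈ σ, 0 ≤ pairing (latticeToReal n m) u) ∧
    ∀ u, u ∈ τ ↔ u ∈ σ ∧ pairing (latticeToReal n m) u = 0

/-- A fan in `M = ℤⁿ`: a finite set of strongly convex rational polyhedral cones, closed under faces,
any two of which intersect in a common face. -/
structure Fan (n : ℕ) where
  cones : Set (PointedCone ℝ (Fin n → ℝ))
  finite : cones.Finite
  rational : ∀ σ ∈ cones, ∃ s : Finset (Fin n → ℤ),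
    σ = PointedCone.hull ℝ (latticeToReal n '' (s : Set (Fin n → ℤ)))
  salient : ∀ σ ∈ cones, ∀ u ∈ σ, -u ∈ σ → u = 0
  face_mem : ∀ σ ∈ cones, ∀ τ, IsFace τ σ → τ ∈ cones
  inf_isFace : ∀ σ ∈ cones, ∀ τ ∈ cones, IsFace (σ ⊓ τ) σ

/-- Every cone is generated by a part of a `ℤ`-basis of `M`. -/
def Fan.IsSmooth {n : ℕ} (S : Fan n) : Prop :=
  ∀ σ ∈ S.cones, ∃ (e : Module.Basis (Fin n) ℤ (Fin n → ℤ)) (J : Set (Fin n)),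
    σ = PointedCone.hull ℝ ((fun j => latticeToReal n (e j)) '' J)

/-- The monoid `σ^∨ ∩ M*`. -/
def dualMonoid {n : ℕ} (σ : PointedCone ℝ (Fin n → ℝ)) : AddSubmonoid (Fin n → ℤ) where
  carrier := {m | ∀ u ∈ σ, 0 ≤ pairing (latticeToReal n m) u}
  zero_mem' u _ := by simp
  add_mem' ha hb u hu := by
    simpa using add_nonneg (ha u hu) (hb u hu)

theorem dualMonoid_anti {n : ℕ} {τ σ : PointedCone ℝ (Fin n → ℝ)} (h : τ ≤ σ) :
    dualMonoid σ ≤ dualMonoid τ := fun _ hm u hu => hm u (h hu)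

/-- The coordinate ring `K[σ^∨ ∩ M*]` of the affine chart of `σ`. -/
abbrev ChartRing (K : Type u) [Field K] {n : ℕ} (σ : PointedCone ℝ (Fin n → ℝ)) : Type u :=
  AddMonoidAlgebra K (dualMonoid σ)

/-- The inclusion `K[σ^∨ ∩ M*] ⊆ K[τ^∨ ∩ M*]` for `τ ⊆ σ`. -/
def chartRestrict (K : Type u) [Field K] {n : ℕ} {τ σ : PointedCone ℝ (Fin n → ℝ)} (h : τ ≤ σ) :
    ChartRing K σ →ₐ[K] ChartRing K τ :=
  AddMonoidAlgebra.mapDomainAlgHom K K (AddSubmonoid.inclusion (dualMonoid_anti h))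

theorem chartRestrict_injective (K : Type u) [Field K] {n : ℕ}
    {τ σ : PointedCone ℝ (Fin n → ℝ)} (h : τ ≤ σ) : Function.Injective (chartRestrict K h) :=
  AddMonoidAlgebra.mapDomain_injective (AddSubmonoid.inclusion_injective _)

theorem chartRestrict_refl (K : Type u) [Field K] {n : ℕ} (σ : PointedCone ℝ (Fin n → ℝ)) :
    chartRestrict K (le_refl σ) = AlgHom.id K (ChartRing K σ) :=
  AddMonoidAlgebra.mapDomainAlgHom_id

theorem chartRestrict_comp (K : Type u) [Field K] {n : ℕ}
    {ρ τ σ : PointedCone ℝ (Fin n → ℝ)} (h : ρ ≤ τ) (h' : τ ≤ σ) :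
    (chartRestrict K h).comp (chartRestrict K h') = chartRestrict K (h.trans h') :=
  (AddMonoidAlgebra.mapDomainAlgHom_comp
    (AddSubmonoid.inclusion (dualMonoid_anti h')) (AddSubmonoid.inclusion (dualMonoid_anti h))).symm

theorem exists_nsmul_add_mem {n : ℕ} {τ σ : PointedCone ℝ (Fin n → ℝ)} {s : Finset (Fin n → ℤ)}
    (hs : σ = PointedCone.hull ℝ (latticeToReal n '' (s : Set (Fin n → ℤ))))
    {m : Fin n → ℤ} (hm : m ∈ dualMonoid σ)
    (hτ : ∀ u, u ∈ τ ↔ u ∈ σ ∧ pairing (latticeToReal n m) u = 0)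
    {w : Fin n → ℤ} (hw : w ∈ dualMonoid τ) :
    ∃ k : ℕ, ∀ l : ℕ, k ≤ l → l • m + w ∈ dualMonoid σ := by
  have key : ∀ v ∈ s, ∃ k : ℕ, ∀ l : ℕ, k ≤ l →
      0 ≤ pairing (latticeToReal n (l • m + w)) (latticeToReal n v) := by
    intro v hv
    have hvσ : latticeToReal n v ∈ σ := hs ▸ PointedCone.subset_hull ⟨v, hv, rfl⟩
    have h0 := hm _ hvσ
    rcases h0.eq_or_lt with h0 | h0
    · refine ⟨0, fun l _ => ?_⟩
      have := hw _ ((hτ _).2 ⟨hvσ, h0.symm⟩)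
      rw [map_add, map_nsmul, map_add, map_nsmul, LinearMap.add_apply, LinearMap.smul_apply, ← h0,
        smul_zero, zero_add]
      exact this
    · obtain ⟨k, hk⟩ := exists_nat_gt
        (-(pairing (latticeToReal n w) (latticeToReal n v)) /
          pairing (latticeToReal n m) (latticeToReal n v))
      refine ⟨k, fun l hl => ?_⟩
      rw [div_lt_iff₀ h0] at hk
      have hl' : (k : ℝ) ≤ l := by exact_mod_cast hl
      have := mul_le_mul_of_nonneg_right hl' h0.le
      rw [map_add, map_nsmul, map_add, map_nsmul, LinearMap.add_apply, LinearMap.smul_apply,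
        nsmul_eq_mul]
      linarith
  choose! k hk using key
  refine ⟨s.sup k, fun l hl u hu => ?_⟩
  rw [hs] at hu
  induction hu using Submodule.span_induction with
  | mem x hx =>
    obtain ⟨v, hv, rfl⟩ := hx
    exact hk v hv l ((Finset.le_sup hv).trans hl)
  | zero => simp
  | add x y _ _ hx hy => rw [map_add]; exact add_nonneg hx hy
  | smul a x _ hx =>
    have : pairing (latticeToReal n (l • m + w)) (a • x)
      = (a : ℝ) * pairing (latticeToReal n (l • m + w)) x := by
      rw [← smul_eq_mul, ← map_smul]; rfl
    rw [this]
    exact mul_nonneg a.2 hx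

theorem isLocalization_chart (K : Type u) [Field K] {n : ℕ} {τ σ : PointedCone ℝ (Fin n → ℝ)}
    {s : Finset (Fin n → ℤ)}
    (hs : σ = PointedCone.hull ℝ (latticeToReal n '' (s : Set (Fin n → ℤ)))) (h : τ ≤ σ)
    {m : Fin n → ℤ} (hm : m ∈ dualMonoid σ)
    (hτ : ∀ u, u ∈ τ ↔ u ∈ σ ∧ pairing (latticeToReal n m) u = 0) :
    letI := (chartRestrict K h).toRingHom.toAlgebra
    IsLocalization.Away (AddMonoidAlgebra.single (⟨m, hm⟩ : dualMonoid σ) (1 : K) : ChartRing K σ)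
      (ChartRing K τ) := by
  let _ := (chartRestrict K h).toRingHom.toAlgebra
  have hmap : ∀ x, algebraMap (ChartRing K σ) (ChartRing K τ) x = chartRestrict K h x :=
    fun _ => rfl
  have hsing : ∀ (a : dualMonoid σ) (c : K), chartRestrict K h (AddMonoidAlgebra.single a c) =
      AddMonoidAlgebra.single (⟨a.1, dualMonoid_anti h a.2⟩ : dualMonoid τ) c := by
    intro a c
    exact AddMonoidAlgebra.mapDomain_single
  have hneg : -m ∈ dualMonoid τ := fun u hu => by
    simp [((hτ u).1 hu).2]
  have hpow : ∀ k : ℕ, (AddMonoidAlgebra.single (⟨m, hm⟩ : dualMonoid σ) (1 : K)) ^ k =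
      AddMonoidAlgebra.single (k • (⟨m, hm⟩ : dualMonoid σ)) (1 : K) := by
    intro k
    simp [AddMonoidAlgebra.single_pow]
  refine (isLocalization_iff _ _).2 ⟨?_, ?_, ?_⟩
  · rintro ⟨_, k, rfl⟩
    simp only [map_pow]
    refine IsUnit.pow _ (IsUnit.of_mul_eq_one
      (AddMonoidAlgebra.single (⟨-m, hneg⟩ : dualMonoid τ) (1 : K)) ?_)
    rw [hmap, hsing, AddMonoidAlgebra.single_mul_single]
    simp only [mul_one, AddMonoidAlgebra.one_def]
    congr 1
    ext1
    simp
  · intro z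
    suffices H : ∃ k : ℕ, ∀ l : ℕ, k ≤ l → ∃ x : ChartRing K σ,
        z * chartRestrict K h ((AddMonoidAlgebra.single (⟨m, hm⟩ : dualMonoid σ) (1 : K)) ^ l) =
          chartRestrict K h x by
      obtain ⟨k, hk⟩ := H
      obtain ⟨x, hx⟩ := hk k le_rfl
      exact ⟨(x, ⟨_, k, rfl⟩), hx⟩
    induction z using AddMonoidAlgebra.induction_linear with
    | zero => exact ⟨0, fun l _ => ⟨0, by simp⟩⟩
    | add a b ha hb =>
      obtain ⟨ka, ha⟩ := ha
      obtain ⟨kb, hb⟩ := hb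
      refine ⟨max ka kb, fun l hl => ?_⟩
      obtain ⟨x, hx⟩ := ha l (le_trans (le_max_left _ _) hl)
      obtain ⟨y, hy⟩ := hb l (le_trans (le_max_right _ _) hl)
      exact ⟨x + y, by rw [add_mul, hx, hy, map_add]⟩
    | single w c =>
      obtain ⟨k, hk⟩ := exists_nsmul_add_mem hs hm hτ w.2
      refine ⟨k, fun l hl => ⟨AddMonoidAlgebra.single ⟨_, hk l hl⟩ c, ?_⟩⟩
      rw [hpow, hsing, hsing, AddMonoidAlgebra.single_mul_single, mul_one]
      congr 1
      ext1
      simp [add_comm]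
  · intro x y hxy
    exact ⟨1, by rw [chartRestrict_injective K h hxy]⟩

theorem Fan.isFace_of_le {n : ℕ} (S : Fan n) {τ σ : PointedCone ℝ (Fin n → ℝ)} (hτ : τ ∈ S.cones)
    (hσ : σ ∈ S.cones) (h : τ ≤ σ) : IsFace τ σ := by
  simpa [inf_eq_right.2 h] using S.inf_isFace σ hσ τ hτ

/-- The diagram of the affine charts `Spec K[σ^∨ ∩ M*]`, `σ` in the fan, and their inclusions. -/
def Fan.chartDiagram {n : ℕ} (S : Fan n) (K : Type u) [Field K] : S.cones ⥤ Scheme.{u} where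
  obj σ := Spec (CommRingCat.of (ChartRing K σ.1))
  map {τ σ} h := Spec.map (CommRingCat.ofHom
    (chartRestrict K (show τ.1 ≤ σ.1 from leOfHom h)).toRingHom)
  map_id σ := by
    rw [chartRestrict_refl]
    exact Spec.map_id _
  map_comp {ρ τ σ} f g := by
    rw [← Spec.map_comp, ← CommRingCat.ofHom_comp,
      ← chartRestrict_comp K (show ρ.1 ≤ τ.1 from leOfHom f) (show τ.1 ≤ σ.1 from leOfHom g)]
    rfl

instance {n : ℕ} (S : Fan n) : Finite S.cones := S.finite

instance {n : ℕ} (S : Fan n) (K : Type u) [Field K] {τ σ : S.cones} (h : τ ⟶ σ) :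
    IsOpenImmersion ((S.chartDiagram K).map h) := by
  obtain ⟨m, hm, hτ⟩ := S.isFace_of_le τ.2 σ.2 (leOfHom h)
  obtain ⟨s, hs⟩ := S.rational σ.1 σ.2
  let _ := (chartRestrict K (show τ.1 ≤ σ.1 from leOfHom h)).toRingHom.toAlgebra
  have := isLocalization_chart K hs (leOfHom h) hm hτ
  exact IsOpenImmersion.of_isLocalization (R := ChartRing K σ.1) (S := ChartRing K τ.1)
    (AddMonoidAlgebra.single (⟨m, hm⟩ : dualMonoid σ.1) (1 : K))

theorem Fan.mem_range_chartDiagram {n : ℕ} (S : Fan n) (K : Type u) [Field K] {τ σ : S.cones}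
    (h : τ ⟶ σ) {m : Fin n → ℤ} (hm : m ∈ dualMonoid σ.1)
    (hτ : ∀ u, u ∈ τ.1 ↔ u ∈ σ.1 ∧ pairing (latticeToReal n m) u = 0)
    (x : PrimeSpectrum (ChartRing K σ.1)) :
    (∃ y, (S.chartDiagram K).map h y = x) ↔
      AddMonoidAlgebra.single (⟨m, hm⟩ : dualMonoid σ.1) (1 : K) ∉ x.asIdeal := by
  obtain ⟨s, hs⟩ := S.rational σ.1 σ.2
  let _ := (chartRestrict K (show τ.1 ≤ σ.1 from leOfHom h)).toRingHom.toAlgebra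
  have := isLocalization_chart K hs (leOfHom h) hm hτ
  exact Set.ext_iff.1 (PrimeSpectrum.localization_away_comap_range (ChartRing K τ.1)
    (AddMonoidAlgebra.single (⟨m, hm⟩ : dualMonoid σ.1) (1 : K))) x

instance {n : ℕ} (S : Fan n) (K : Type u) [Field K] :
    (S.chartDiagram K ⋙ Scheme.forget).IsLocallyDirected where
  cond {i j k} fi fj xi xj hx := by
    obtain ⟨m, hm, hi⟩ := S.isFace_of_le i.2 k.2 (leOfHom fi)
    obtain ⟨m', hm', hj⟩ := S.isFace_of_le j.2 k.2 (leOfHom fj)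
    let l : S.cones := ⟨i.1 ⊓ j.1, S.face_mem i.1 i.2 _ (S.inf_isFace i.1 i.2 j.1 j.2)⟩
    have hli : l ≤ i := inf_le_left (a := i.1) (b := j.1)
    have hlj : l ≤ j := inf_le_right (a := i.1) (b := j.1)
    have hl : ∀ u, u ∈ l.1 ↔ u ∈ k.1 ∧ pairing (latticeToReal n (m + m')) u = 0 := by
      intro u
      change u ∈ i.1 ∧ u ∈ j.1 ↔ _
      rw [hi, hj]
      simp only [map_add, LinearMap.add_apply]
      constructor
      · rintro ⟨⟨h1, h2⟩, _, h3⟩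
        exact ⟨h1, by rw [h2, h3, add_zero]⟩
      · rintro ⟨h1, h2⟩
        have := hm u h1
        have := hm' u h1
        exact ⟨⟨h1, by linarith⟩, h1, by linarith⟩
    let x : PrimeSpectrum (ChartRing K k.1) := (S.chartDiagram K).map fi xi
    have h1 := (S.mem_range_chartDiagram K fi hm hi x).1 ⟨xi, rfl⟩
    have h2 := (S.mem_range_chartDiagram K fj hm' hj x).1 ⟨xj, hx.symm⟩
    have h3 : AddMonoidAlgebra.single
        (⟨m + m', (dualMonoid k.1).add_mem hm hm'⟩ : dualMonoid k.1) (1 : K) ∉ x.asIdeal := by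
      have : AddMonoidAlgebra.single
          (⟨m + m', (dualMonoid k.1).add_mem hm hm'⟩ : dualMonoid k.1) (1 : K) =
          AddMonoidAlgebra.single (⟨m, hm⟩ : dualMonoid k.1) (1 : K) *
          AddMonoidAlgebra.single (⟨m', hm'⟩ : dualMonoid k.1) (1 : K) := by
        rw [AddMonoidAlgebra.single_mul_single, mul_one]
        rfl
      rw [this]
      exact fun h => (x.2.mem_or_mem h).elim h1 h2
    obtain ⟨y, hy⟩ := (S.mem_range_chartDiagram K (homOfLE hli ≫ fi)
      ((dualMonoid k.1).add_mem hm hm') hl x).2 h3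
    have hfg : homOfLE hlj ≫ fj = homOfLE hli ≫ fi := Subsingleton.elim _ _
    refine ⟨l, homOfLE hli, homOfLE hlj, y, ?_, ?_⟩
    · apply ((S.chartDiagram K).map fi).isOpenEmbedding.injective
      rw [Functor.map_comp] at hy
      exact hy
    · apply ((S.chartDiagram K).map fj).isOpenEmbedding.injective
      rw [← hfg, Functor.map_comp] at hy
      exact hy.trans hx

/-- The toric variety over `K` of a fan: its affine charts glued along the charts of common faces. -/
def Fan.toricVariety {n : ℕ} (S : Fan n) (K : Type u) [Field K] : Scheme.{u} :=
  colimit (S.chartDiagram K)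

/-- The inclusion of the affine chart of `σ`, an open immersion. -/
def Fan.chartι {n : ℕ} (S : Fan n) (K : Type u) [Field K] (σ : S.cones) :
    Spec (CommRingCat.of (ChartRing K σ.1)) ⟶ S.toricVariety K :=
  colimit.ι (S.chartDiagram K) σ

/-- The structure map of the toric variety to `Spec K`. -/
def Fan.structureMap {n : ℕ} (S : Fan n) (K : Type u) [Field K] :
    S.toricVariety K ⟶ Spec (CommRingCat.of K) :=
  colimit.desc (S.chartDiagram K)
    { pt := Spec (CommRingCat.of K)
      ι :=
        { app σ := Spec.map (CommRingCat.ofHom (algebraMap K (ChartRing K σ.1)))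
          naturality τ σ h := by
            refine (Spec.map_comp _ _).symm.trans ?_
            rw [← CommRingCat.ofHom_comp]
            refine Eq.trans ?_ (Category.comp_id _).symm
            congr 2
            exact (chartRestrict K (show τ.1 ≤ σ.1 from leOfHom h)).comp_algebraMap } }

/-- The exponents of `x` below any bound are finite in number, so `x = ∑ c_j T^(λ_j)` is a finite sum
or has `λ_j → ∞`. -/
def IsLeftFinite {k : Type u} [Field k] {Q : AddSubgroup ℝ} (x : HahnSeries Q k) : Prop :=
  ∀ C : ℝ, {q : Q | x.coeff q ≠ 0 ∧ (q : ℝ) ≤ C}.Finite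

section
variable {k : Type u} [Field k] {Q : AddSubgroup ℝ}

theorem IsLeftFinite.single (q : Q) (c : k) : IsLeftFinite (HahnSeries.single q c) := by
  intro C
  refine (Set.finite_singleton q).subset fun r hr => ?_
  by_contra h
  exact hr.1 (HahnSeries.coeff_single_of_ne h)

theorem IsLeftFinite.add {x y : HahnSeries Q k} (hx : IsLeftFinite x) (hy : IsLeftFinite y) :
    IsLeftFinite (x + y) := by
  intro C
  refine ((hx C).union (hy C)).subset fun r hr => ?_
  by_cases h : x.coeff r = 0
  · exact Or.inr ⟨fun h' => hr.1 (by simp [h, h']), hr.2⟩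
  · exact Or.inl ⟨h, hr.2⟩

theorem IsLeftFinite.neg {x : HahnSeries Q k} (hx : IsLeftFinite x) : IsLeftFinite (-x) := by
  intro C
  exact (hx C).subset fun r hr => ⟨fun h => hr.1 (by simp [h]), hr.2⟩

theorem IsLeftFinite.mul {x y : HahnSeries Q k} (hx : IsLeftFinite x) (hy : IsLeftFinite y) :
    IsLeftFinite (x * y) := by
  intro C
  refine Set.Finite.subset (((hx (C - y.order)).prod (hy (C - x.order))).image
    fun p : Q × Q => p.1 + p.2) fun r hr => ?_
  obtain ⟨i, hi, j, hj, rfl⟩ := HahnSeries.support_mul_subset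
    (show r ∈ (x * y).support from hr.1)
  have h1 : (x.order : ℝ) ≤ i := HahnSeries.order_le_of_coeff_ne_zero hi
  have h2 : (y.order : ℝ) ≤ j := HahnSeries.order_le_of_coeff_ne_zero hj
  have h3 : (i : ℝ) + j ≤ C := by simpa using hr.2
  exact ⟨(i, j), ⟨⟨hi, by linarith⟩, ⟨hj, by linarith⟩⟩, rfl⟩

theorem IsLeftFinite.pow {x : HahnSeries Q k} (hx : IsLeftFinite x) (n : ℕ) :
    IsLeftFinite (x ^ n) := by
  induction n with
  | zero => simpa using IsLeftFinite.single (0 : Q) (1 : k)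
  | succ n ih => rw [pow_succ]; exact ih.mul hx

theorem IsLeftFinite.hsum_powers {x : HahnSeries Q k} (hx : IsLeftFinite x) :
    IsLeftFinite (HahnSeries.SummableFamily.powers x).hsum := by
  by_cases h : 0 < x.orderTop
  swap
  · have := HahnSeries.SummableFamily.one_sub_self_mul_hsum_powers (Γ := Q) (R := k) (x := 0)
      (by simp)
    have h2 : HahnSeries.SummableFamily.powers x
        = HahnSeries.SummableFamily.powers (0 : HahnSeries Q k) := by
      ext1 n
      simp [HahnSeries.SummableFamily.powers, h]
    rw [h2, ← one_mul (HahnSeries.SummableFamily.hsum _), ← sub_zero (1 : HahnSeries Q k), this]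
    simpa using IsLeftFinite.single (0 : Q) (1 : k)
  · intro C
    by_cases hx0 : x = 0
    · subst hx0
      rw [HahnSeries.SummableFamily.powers_zero]
      simpa using IsLeftFinite.single (0 : Q) (1 : k) C
    have hpos : (0 : ℝ) < x.order := by
      rw [← HahnSeries.order_eq_orderTop_of_ne_zero hx0, WithTop.coe_pos] at h
      exact h
    obtain ⟨N, hN⟩ := exists_nat_gt (C / x.order)
    refine ((Set.finite_lt_nat N).biUnion fun n _ => hx.pow n C).subset fun r hr => ?_
    obtain ⟨n, hn⟩ : ∃ n : ℕ, (x ^ n).coeff r ≠ 0 := by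
      by_contra! hcon
      apply hr.1
      rw [HahnSeries.SummableFamily.coeff_hsum]
      simp [h, hcon]
    have h1 : (x ^ n).order ≤ r := HahnSeries.order_le_of_coeff_ne_zero hn
    rw [HahnSeries.order_pow] at h1
    have h2 : (n : ℝ) * x.order ≤ r := by simpa using (show ((n • x.order : Q) : ℝ) ≤ r from h1)
    refine Set.mem_biUnion (x := n) ?_ ⟨hn, hr.2⟩
    have h3 : (n : ℝ) ≤ C / x.order := by
      rw [le_div_iff₀ hpos]; linarith [hr.2]
    exact_mod_cast h3.trans_lt hN

theorem IsLeftFinite.inv {x : HahnSeries Q k} (hx : IsLeftFinite x) : IsLeftFinite x⁻¹ := by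
  rw [HahnSeries.inv_def, sub_eq_add_neg]
  refine (IsLeftFinite.single _ _).mul (IsLeftFinite.hsum_powers
    (IsLeftFinite.add ?_ ((IsLeftFinite.single _ _).mul hx).neg))
  simpa using IsLeftFinite.single (0 : Q) (1 : k)

end

/-- The Novikov field `Λ_{k,Q}` of the series `∑ c_j T^(λ_j)` with `c_j ∈ k`, `λ_j ∈ Q`, `λ_j → ∞`. -/
def NovikovField (k : Type u) [Field k] (Q : AddSubgroup ℝ) : Subfield (HahnSeries Q k) where
  carrier := {x | IsLeftFinite x}
  mul_mem' := IsLeftFinite.mul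
  one_mem' := by simpa using IsLeftFinite.single (0 : Q) (1 : k)
  add_mem' := IsLeftFinite.add
  zero_mem' := by simpa using IsLeftFinite.single (0 : Q) (0 : k)
  neg_mem' := IsLeftFinite.neg
  inv_mem' _ := IsLeftFinite.inv

/-- `Ξ`: the lattice points of `Δ ⊆ M*_ℝ`. -/
def latticePoints {n : ℕ} (Δ : Set (Fin n → ℝ)) : Set (Fin n → ℤ) := {p | latticeToReal n p ∈ Δ}

/-- `Δ` is the convex hull of a nonempty finite set of lattice points. -/
def IsLatticePolytope {n : ℕ} (Δ : Set (Fin n → ℝ)) : Prop :=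
  ∃ V : Finset (Fin n → ℤ), V.Nonempty ∧
    Δ = convexHull ℝ (latticeToReal n '' (V : Set (Fin n → ℤ)))

/-- The cone of those `u ∈ M_ℝ` whose minimum over `Δ` is attained at `p`. For `p` running over the
vertices of `Δ` these are the maximal cones of the (inner) normal fan of `Δ`. -/
def normalCone {n : ℕ} (Δ : Set (Fin n → ℝ)) (p : Fin n → ℝ) : PointedCone ℝ (Fin n → ℝ) where
  carrier := {u | ∀ q ∈ Δ, pairing p u ≤ pairing q u}
  zero_mem' q _ := by simp
  add_mem' ha hb q hq := by
    rw [map_add, map_add]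
    exact add_le_add (ha q hq) (hb q hq)
  smul_mem' c u hu q hq := by
    have h : ∀ r : Fin n → ℝ, pairing r (c • u) = (c : ℝ) * pairing r u := fun r => by
      rw [← smul_eq_mul, ← map_smul]; rfl
    rw [h, h]
    exact mul_le_mul_of_nonneg_left (hu q hq) c.2

/-- Every cone of `S` lies in a cone of the normal fan of `Δ`. So the support function
`u ↦ min_Δ ⟨·, u⟩` is linear on each cone of `S`, and it defines a line bundle `L_Δ` on the toric
variety, with the lattice points of `Δ` as sections. For a complete fan whose line bundle `L_Δ` is
ample, `S` is equal to the normal fan of `Δ`, and this holds. -/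
def Fan.IsSubordinate {n : ℕ} (S : Fan n) (Δ : Set (Fin n → ℝ)) : Prop :=
  ∀ σ ∈ S.cones, ∃ p ∈ Δ.extremePoints ℝ, σ ≤ normalCone Δ p

/-- The Laurent polynomial `∑_{p ∈ Ξ} b_p z^p`. -/
def laurent {K : Type u} [Field K] {n : ℕ} {Δ : Set (Fin n → ℝ)} (b : latticePoints Δ →₀ K) :
    AddMonoidAlgebra K (Fin n → ℤ) :=
  b.sum fun p c => AddMonoidAlgebra.single p.1 c

/-- The ideal of the hypersurface in the chart of `σ`. The local generators of `L_Δ` there are the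
`z^m`, `m` a lattice point of the face of `Δ` dual to `σ`; so the local equation is
`∑ b_p z^(p - m) = 0`. Different choices of `m` differ by a unit of the chart. -/
def chartIdeal {K : Type u} [Field K] {n : ℕ} {Δ : Set (Fin n → ℝ)} (b : latticePoints Δ →₀ K)
    (σ : PointedCone ℝ (Fin n → ℝ)) : Ideal (ChartRing K σ) :=
  Ideal.span {g | ∃ m ∈ latticePoints Δ, σ ≤ normalCone Δ (latticeToReal n m) ∧
    AddMonoidAlgebra.mapDomain (dualMonoid σ).subtype g =
      AddMonoidAlgebra.single (-m) (1 : K) * laurent b}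

/-- The ideal sheaf of the functions on the toric variety which vanish on the closed subscheme
`Spec (K[σ^∨ ∩ M*] / chartIdeal b σ)` of the chart of `σ`, for each cone `σ` of the fan. -/
def Fan.hypersurfaceIdeal {K : Type u} [Field K] {n : ℕ} (S : Fan n) {Δ : Set (Fin n → ℝ)}
    (b : latticePoints Δ →₀ K) : (S.toricVariety K).IdealSheafData :=
  ⨅ σ : S.cones, Scheme.Hom.ker
    (Spec.map (CommRingCat.ofHom (Ideal.Quotient.mk (chartIdeal b σ.1))) ≫ S.chartι K σ)

/-- The hypersurface `{∑ b_p z^p = 0}`, a closed subscheme of the toric variety. -/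
def Fan.hypersurface {K : Type u} [Field K] {n : ℕ} (S : Fan n) {Δ : Set (Fin n → ℝ)}
    (b : latticePoints Δ →₀ K) : Scheme.{u} :=
  (S.hypersurfaceIdeal b).subscheme

/-- The structure map of the hypersurface to `Spec K`. -/
def Fan.hypersurfaceStructureMap {K : Type u} [Field K] {n : ℕ} (S : Fan n)
    {Δ : Set (Fin n → ℝ)} (b : latticePoints Δ →₀ K) :
    S.hypersurface b ⟶ Spec (CommRingCat.of K) :=
  (S.hypersurfaceIdeal b).subschemeι ≫ S.structureMap K

/-- The smallest concave function `ψ` on `Δ` with `ψ p ≥ -v p` for all lattice points `p` of `Δ`.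
(Finite on `Δ` if `v p ≠ ∞` at the vertices; values outside `Δ` are not used.) -/
def upperHull {n : ℕ} (Δ : Set (Fin n → ℝ)) (v : latticePoints Δ → WithTop ℝ)
    (x : Fin n → ℝ) : ℝ :=
  sInf {r | ∃ g : (Fin n → ℝ) → ℝ, ConcaveOn ℝ Δ g ∧
    (∀ p : latticePoints Δ, ((-(g (latticeToReal n p.1)) : ℝ) : WithTop ℝ) ≤ v p) ∧ g x = r}

/-- `D` is a domain of linearity of `ψ`: a maximal convex subset of `Δ` on which `ψ` is affine. -/
def IsLinearityDomain {n : ℕ} (Δ : Set (Fin n → ℝ)) (ψ : (Fin n → ℝ) → ℝ)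
    (D : Set (Fin n → ℝ)) : Prop :=
  Maximal (fun E => E ⊆ Δ ∧ Convex ℝ E ∧ ∃ l : (Fin n → ℝ) →ᵃ[ℝ] ℝ, ∀ x ∈ E, ψ x = l x) D

/-- The normalized affine volume of the lattice simplex with vertices `q 0, …, q d` (the smallest
nonzero volume is `1`): the index of the lattice generated by the `q i - q 0` in the lattice of all
lattice vectors parallel to the simplex. -/
def normalizedVolume {n d : ℕ} (q : Fin (d + 1) → Fin n → ℤ) : ℕ :=
  (AddSubgroup.closure (Set.range fun i => q i - q 0)).relIndex
    ((Submodule.span ℝ (Set.range fun i =>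
      latticeToReal n (q i - q 0))).toAddSubgroup.comap (latticeToReal n))

/-- The subdivision of `Δ` induced by `v` consists of simplices whose normalized affine volumes are
not divisible by `c` and whose only lattice points are their vertices. -/
def InducesGoodSubdivision {n : ℕ} (Δ : Set (Fin n → ℝ)) (v : latticePoints Δ → WithTop ℝ)
    (c : ℕ) : Prop :=
  ∀ D, IsLinearityDomain Δ (upperHull Δ v) D →
    ∃ (d : ℕ) (q : Fin (d + 1) → Fin n → ℤ),
      AffineIndependent ℝ (fun i => latticeToReal n (q i)) ∧
      D = convexHull ℝ (Set.range fun i => latticeToReal n (q i)) ∧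
      latticePoints D ⊆ Set.range q ∧
      ¬ c ∣ normalizedVolume q

end

end TropicalRegularity

namespace TropicalRegularity

open CategoryTheory CategoryTheory.Limits AlgebraicGeometry

noncomputable section

/-! Smoothness is local, and on the chart of a cone `σ` the hypersurface is cut out by a single
equation `f`, the sum of the terms `b_p z^(p - p₀)` with `p₀` a vertex of `Δ` dual to `σ`. As `σ` is
spanned by part of a basis, the chart is smooth over `K`, so by a Jacobian criterion a non-smooth
hypersurface has a closed point where `f` and `D f` vanish for every derivation `D`. The residue
field `L` of that point is finite over `K` by the Nullstellensatz, and the valuation extends to `L`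
(`exists_addValuation_extension`).

Let `F_p` be the value of the term of `p` at the point. The non-zero values of the monomials `z^(p -
p₀)` have valuations given by a linear function `ν` of `p - p₀`; a second linear function `h` is `0`
on these exponents and positive on those whose monomial vanishes (`valuation_of_point`). Let `c` be
the minimal valuation of the `F_p`, attained for `p` in a set `A`. For large `C` the affine function
`ν(p - p₀) + C h(p - p₀) - c` lies above `-v`, with equality on `A`, so it supports the concave hull
there and `A` lies in one cell of the subdivision (`exists_linearityDomain_of_support`). By
hypothesis the cell is a simplex and `A` consists of vertices `q i` of it.

If `A = {q 0}`, one term of `∑ F_p = 0` has strictly smallest valuation, which is absurd. Otherwise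
`q j ∈ A` for some `j ≠ 0`. Let `N` be the normalized volume. There is an integral covector `u`
whose pairing with `q i - q 0` is `N` for `i = j` and `0` otherwise (`exists_coordinate`). The
logarithmic derivative along `u`, combined with `f = 0`, gives `∑ ⟨p - q 0, u⟩ F_p = 0`. As `char K`
does not divide `N`, the valuation of `N` is `0`, so the term of `q j` is the unique one of minimal
valuation: again absurd (`tropical_regularity`). -/

/-! ### Ideal sheaves and open immersions -/

theorem comap_iInf_of_isOpenImmersion {X Y : Scheme.{u}} {ι : Type*} [Finite ι]
    (I : ι → Y.IdealSheafData) (f : X ⟶ Y) [IsOpenImmersion f] :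
    (⨅ i, I i).comap f = ⨅ i, (I i).comap f := by
  refine Scheme.IdealSheafData.ext (funext fun U => ?_)
  rw [Scheme.IdealSheafData.ideal_comap_of_isOpenImmersion, Scheme.IdealSheafData.ideal_iInf,
    Scheme.IdealSheafData.ideal_iInf, iInf_apply, iInf_apply, Ideal.comap_iInf]
  exact iInf_congr fun i => (Scheme.IdealSheafData.ideal_comap_of_isOpenImmersion _ _ _).symm

theorem comap_ker_of_isPullback {P U Y Z : Scheme.{u}} {p : P ⟶ U} {q : P ⟶ Z} {i : U ⟶ Y}
    {w : Z ⟶ Y} [IsOpenImmersion i] [QuasiCompact w] (H : IsPullback p q i w) :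
    w.ker.comap i = p.ker := by
  refine Scheme.IdealSheafData.ext (funext fun V => ?_)
  rw [Scheme.IdealSheafData.ideal_comap_of_isOpenImmersion,
    Scheme.ker_ideal_of_isPullback_of_isOpenImmersion w p q i H]

/-- As `i` is a monomorphism, the base change of `z ≫ i` along `i` is `z` itself. -/
theorem comap_ker_comp_self {U Y Z : Scheme.{u}} (z : Z ⟶ U) (i : U ⟶ Y) [IsOpenImmersion i]
    [QuasiCompact (z ≫ i)] : (z ≫ i).ker.comap i = z.ker :=
  comap_ker_of_isPullback (q := 𝟙 Z) ⟨⟨by simp⟩, ⟨PullbackCone.IsLimit.mk _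
    (fun s => s.snd) (fun s => by
      rw [← cancel_mono i, Category.assoc, s.condition]) (fun s => by simp)
      (fun s m h1 h2 => by simpa using h2)⟩⟩

/-- The ring map `R → Γ(X, ⊤)` of a morphism `X ⟶ Spec R`. -/
def sectionsHom {X : Scheme.{u}} {R : CommRingCat.{u}} (p : X ⟶ Spec R) : R →+* Γ(X, ⊤) :=
  ((Scheme.ΓSpecIso R).inv ≫ p.appTop).hom

theorem sectionsHom_comp_specMap {X : Scheme.{u}} {R S : CommRingCat.{u}} (p : X ⟶ Spec S)
    (φ : R ⟶ S) : sectionsHom (p ≫ Spec.map φ) = (sectionsHom p).comp φ.hom := by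
  rw [sectionsHom, sectionsHom, ← CommRingCat.hom_comp, Scheme.Hom.comp_appTop,
    Scheme.ΓSpecIso_inv_naturality_assoc]

/-- On an affine target, kernels are determined by global sections. This tests the inclusion for a
source `X` that need not be affine, such as a fibre product of charts. -/
theorem ker_specMap_mk_le {X : Scheme.{u}} {R : Type u} [CommRing R] (I : Ideal R)
    (p : X ⟶ Spec (CommRingCat.of R)) (h : I ≤ RingHom.ker (sectionsHom p)) :
    (Spec.map (CommRingCat.ofHom (Ideal.Quotient.mk I))).ker ≤ p.ker := by
  rw [Scheme.ker_of_isAffine, Scheme.ker_of_isAffine]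
  refine Scheme.IdealSheafData.le_of_isAffine ?_
  simp only [Scheme.IdealSheafData.ofIdealTop_ideal]
  refine Ideal.map_mono fun r hr => ?_
  obtain ⟨r', rfl⟩ : ∃ r', (Scheme.ΓSpecIso (CommRingCat.of R)).inv r' = r :=
    (ConcreteCategory.bijective_of_isIso (Scheme.ΓSpecIso (CommRingCat.of R)).inv).2 r
  have h1 : r' ∈ I := by
    have h2 : sectionsHom (𝟙 _ ≫ Spec.map (CommRingCat.ofHom (Ideal.Quotient.mk I))) r' = 0 := by
      rw [Category.id_comp]; exact hr
    rw [sectionsHom_comp_specMap] at h2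
    have h3 : Function.Injective (sectionsHom (𝟙 (Spec (CommRingCat.of (R ⧸ I))))) := by
      rw [sectionsHom, Scheme.Hom.id_appTop, Category.comp_id]
      exact (ConcreteCategory.bijective_of_isIso (Scheme.ΓSpecIso (CommRingCat.of (R ⧸ I))).inv).1
    exact Ideal.Quotient.eq_zero_iff_mem.1 (h3 (h2.trans (map_zero _).symm))
  exact h h1

/-! ### Gluing: reduction of smoothness to the charts -/

section

variable {K : Type u} [Field K] {n : ℕ} {Δ : Set (Fin n → ℝ)} (b : latticePoints Δ →₀ K)

/-- The closed immersion of the hypersurface in the chart of `σ`. -/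
def chartHypersurfaceι (σ : PointedCone ℝ (Fin n → ℝ)) :
    Spec (CommRingCat.of (ChartRing K σ ⧸ chartIdeal b σ)) ⟶ Spec (CommRingCat.of (ChartRing K σ)) :=
  Spec.map (CommRingCat.ofHom (Ideal.Quotient.mk (chartIdeal b σ)))

instance (σ : PointedCone ℝ (Fin n → ℝ)) : IsClosedImmersion (chartHypersurfaceι b σ) :=
  IsClosedImmersion.spec_of_surjective _ Ideal.Quotient.mk_surjective

/-- The inclusion `K[σ^∨ ∩ M*] ⊆ K[M*]`. -/
def chartIncl (K : Type u) [Field K] (σ : PointedCone ℝ (Fin n → ℝ)) :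
    ChartRing K σ →ₐ[K] AddMonoidAlgebra K (Fin n → ℤ) :=
  AddMonoidAlgebra.mapDomainAlgHom K K (dualMonoid σ).subtype

theorem chartIncl_apply (σ : PointedCone ℝ (Fin n → ℝ)) (g : ChartRing K σ) :
    chartIncl K σ g = AddMonoidAlgebra.mapDomain (dualMonoid σ).subtype g := rfl

theorem chartIncl_single (σ : PointedCone ℝ (Fin n → ℝ)) (m : dualMonoid σ) (c : K) :
    chartIncl K σ (AddMonoidAlgebra.single m c) = AddMonoidAlgebra.single m.1 c :=
  AddMonoidAlgebra.mapDomain_single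

theorem chartIncl_injective (σ : PointedCone ℝ (Fin n → ℝ)) :
    Function.Injective (chartIncl K σ) :=
  AddMonoidAlgebra.mapDomain_injective Subtype.val_injective

theorem chartIncl_chartRestrict {τ σ : PointedCone ℝ (Fin n → ℝ)} (h : τ ≤ σ)
    (g : ChartRing K σ) : chartIncl K τ (chartRestrict K h g) = chartIncl K σ g :=
  (DFunLike.congr_fun (AddMonoidAlgebra.mapDomainAlgHom_comp (R := K) (A := K)
    (AddSubmonoid.inclusion (dualMonoid_anti h)) (dualMonoid τ).subtype) g).symm

/-- Every lattice point of the face of `Δ` dual to `σ` gives a local equation. -/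
theorem exists_local_equation {σ : PointedCone ℝ (Fin n → ℝ)} {m : Fin n → ℤ}
    (hσ : σ ≤ normalCone Δ (latticeToReal n m)) :
    ∃ g : ChartRing K σ, chartIncl K σ g = AddMonoidAlgebra.single (-m) (1 : K) * laurent b := by
  have hmem : ∀ p : latticePoints Δ, p.1 - m ∈ dualMonoid σ := fun p u hu => by
    have : pairing (latticeToReal n m) u ≤ pairing (latticeToReal n p.1) u := hσ hu _ p.2
    rw [map_sub, map_sub, LinearMap.sub_apply]
    linarith
  refine ⟨b.sum fun p c => AddMonoidAlgebra.single ⟨p.1 - m, hmem p⟩ c, ?_⟩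
  rw [laurent, Finsupp.sum, Finsupp.sum, Finset.mul_sum, map_sum]
  refine Finset.sum_congr rfl fun p _ => ?_
  rw [chartIncl_single, AddMonoidAlgebra.single_mul_single, one_mul]
  congr 1
  exact sub_eq_neg_add _ _

/-- Local equations based at `m` and `m'` differ by the factor `z^(m' - m)`, which is regular on the
chart of `ρ` because `m` minimizes every `u ∈ ρ` over `Δ`. -/
theorem chartRestrict_mem {ρ σ τ : PointedCone ℝ (Fin n → ℝ)} (hσ : ρ ≤ σ) (hτ : ρ ≤ τ)
    (hn : ∃ m ∈ latticePoints Δ, τ ≤ normalCone Δ (latticeToReal n m)) {g : ChartRing K σ}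
    (hg : g ∈ chartIdeal b σ) :
    chartRestrict K hσ g ∈ (chartIdeal b τ).map (chartRestrict K hτ) := by
  obtain ⟨m', hm', hm'τ⟩ := hn
  obtain ⟨g', hg'⟩ := exists_local_equation b hm'τ
  rw [← Ideal.mem_comap]
  revert hg g
  change chartIdeal b σ ≤ _
  refine Ideal.span_le.2 ?_
  rintro g ⟨m, hm, hmσ, hg⟩
  have hmem : m' - m ∈ dualMonoid ρ := fun u hu => by
    have : pairing (latticeToReal n m) u ≤ pairing (latticeToReal n m') u := hmσ (hσ hu) _ hm'
    rw [map_sub, map_sub, LinearMap.sub_apply]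
    linarith
  have key : chartRestrict K hσ g =
      AddMonoidAlgebra.single (⟨m' - m, hmem⟩ : dualMonoid ρ) (1 : K) * chartRestrict K hτ g' := by
    apply chartIncl_injective
    rw [map_mul, chartIncl_chartRestrict, chartIncl_chartRestrict, hg', chartIncl_single,
      chartIncl_apply, hg, ← mul_assoc,
      AddMonoidAlgebra.single_mul_single, one_mul]
    congr 2
    change -m = m' - m + -m'
    abel
  rw [SetLike.mem_coe, Ideal.mem_comap, key]
  exact Ideal.mul_mem_left _ _ (Ideal.mem_map_of_mem _ (Ideal.subset_span ⟨m', hm', hm'τ, hg'⟩))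

variable (S : Fan n)

instance (σ : S.cones) : IsOpenImmersion (S.chartι K σ) :=
  inferInstanceAs (IsOpenImmersion (colimit.ι (S.chartDiagram K) σ))

theorem Fan.chartι_structureMap (σ : S.cones) : S.chartι K σ ≫ S.structureMap K =
    Spec.map (CommRingCat.ofHom (algebraMap K (ChartRing K σ.1))) :=
  colimit.ι_desc _ _

/-- The intersection of two cones of the fan, as a cone of the fan. -/
def Fan.inter (σ τ : S.cones) : S.cones :=
  ⟨σ.1 ⊓ τ.1, S.face_mem σ.1 σ.2 _ (S.inf_isFace σ.1 σ.2 τ.1 τ.2)⟩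

theorem Fan.specMap_chartRestrict_chartι {τ σ : S.cones} (h : τ.1 ≤ σ.1) :
    Spec.map (CommRingCat.ofHom (chartRestrict K h).toRingHom) ≫ S.chartι K σ = S.chartι K τ :=
  colimit.w (S.chartDiagram K) (homOfLE (show τ ≤ σ from h))

theorem Fan.range_chartι_inter (σ τ : S.cones) :
    Set.range (S.chartι K σ) ∩ Set.range (S.chartι K τ) ⊆ Set.range (S.chartι K (S.inter σ τ)) := by
  rintro _ ⟨⟨x, rfl⟩, ⟨y, hy⟩⟩
  obtain ⟨k, fi, fj, z, hz, _⟩ := (Scheme.IsLocallyDirected.ι_eq_ι_iff (S.chartDiagram K)).1 hy.symm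
  have hk : k.1 ≤ (S.inter σ τ).1 := le_inf (leOfHom fi) (leOfHom fj)
  refine ⟨Spec.map (CommRingCat.ofHom (chartRestrict K hk).toRingHom) z, ?_⟩
  rw [← hz]
  have h1 : S.chartι K (S.inter σ τ)
      (Spec.map (CommRingCat.ofHom (chartRestrict K hk).toRingHom) z) = S.chartι K k z := by
    rw [← S.specMap_chartRestrict_chartι hk]
    rfl
  refine h1.trans ?_
  rw [← S.specMap_chartRestrict_chartι (τ := k) (σ := σ) (leOfHom fi)]
  rfl

/-- This is the gluing condition: in the chart of `σ`, the local ideal vanishes on the part of the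
hypersurface that comes from the chart of `τ`. That part factors through the chart of `σ ∩ τ`, where
the two ideals can be compared. -/
theorem Fan.chartHypersurface_compat [∀ σ : S.cones, QuasiCompact
      (chartHypersurfaceι b σ.1 ≫ S.chartι K σ)]
    (hn : ∀ σ ∈ S.cones, ∃ m ∈ latticePoints Δ, σ ≤ normalCone Δ (latticeToReal n m))
    (σ τ : S.cones) : (chartHypersurfaceι b σ.1).ker ≤
      (chartHypersurfaceι b τ.1 ≫ S.chartι K τ).ker.comap (S.chartι K σ) := by
  rw [comap_ker_of_isPullback (IsPullback.of_hasPullback _ _)]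
  refine ker_specMap_mk_le _ _ fun g hg => ?_
  set P := pullback (S.chartι K σ) (chartHypersurfaceι b τ.1 ≫ S.chartι K τ)
  set p : P ⟶ _ := pullback.fst (S.chartι K σ) (chartHypersurfaceι b τ.1 ≫ S.chartι K τ)
  set s : P ⟶ _ := pullback.snd (S.chartι K σ) (chartHypersurfaceι b τ.1 ≫ S.chartι K τ)
  have hcond : p ≫ S.chartι K σ = s ≫ chartHypersurfaceι b τ.1 ≫ S.chartι K τ := pullback.condition
  have hrange : Set.range (p ≫ S.chartι K σ) ⊆ Set.range (S.chartι K (S.inter σ τ)) := by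
    rintro _ ⟨x, rfl⟩
    refine S.range_chartι_inter σ τ ⟨⟨p x, rfl⟩, ?_⟩
    rw [hcond]
    exact ⟨chartHypersurfaceι b τ.1 (s x), rfl⟩
  let q : P ⟶ _ := IsOpenImmersion.lift (S.chartι K (S.inter σ τ)) (p ≫ S.chartι K σ) hrange
  have hq : q ≫ S.chartι K (S.inter σ τ) = p ≫ S.chartι K σ := IsOpenImmersion.lift_fac _ _ _
  have hlσ : (S.inter σ τ).1 ≤ σ.1 := inf_le_left
  have hlτ : (S.inter σ τ).1 ≤ τ.1 := inf_le_right
  have hqσ : q ≫ Spec.map (CommRingCat.ofHom (chartRestrict K hlσ).toRingHom) = p := by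
    rw [← cancel_mono (S.chartι K σ), Category.assoc, S.specMap_chartRestrict_chartι, hq]
  have hqτ : q ≫ Spec.map (CommRingCat.ofHom (chartRestrict K hlτ).toRingHom) =
      s ≫ chartHypersurfaceι b τ.1 := by
    rw [← cancel_mono (S.chartι K τ), Category.assoc, S.specMap_chartRestrict_chartι, hq, hcond,
      Category.assoc]
  have h0 : (chartIdeal b τ.1).map (chartRestrict K hlτ) ≤ RingHom.ker (sectionsHom q) := by
    refine Ideal.map_le_iff_le_comap.2 fun x hx => ?_
    have h2 : sectionsHom (s ≫ chartHypersurfaceι b τ.1) x = 0 := by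
      rw [chartHypersurfaceι, sectionsHom_comp_specMap]
      have : Ideal.Quotient.mk (chartIdeal b τ.1) x = 0 := Ideal.Quotient.eq_zero_iff_mem.2 hx
      simp [this]
    rw [← hqτ, sectionsHom_comp_specMap] at h2
    exact h2
  have h1 := h0 (chartRestrict_mem b hlσ hlτ (hn τ.1 τ.2) hg)
  rw [← hqσ, RingHom.mem_ker, sectionsHom_comp_specMap]
  exact h1

/-- The global ideal is an intersection over all charts. Restricted to the chart of `σ`, the member
of `σ` gives the local ideal, and compatibility shows that the other members do not make it smaller.
-/
theorem Fan.comap_hypersurfaceIdeal [∀ σ : S.cones, QuasiCompact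
      (chartHypersurfaceι b σ.1 ≫ S.chartι K σ)]
    (hn : ∀ σ ∈ S.cones, ∃ m ∈ latticePoints Δ, σ ≤ normalCone Δ (latticeToReal n m))
    (σ : S.cones) :
    (S.hypersurfaceIdeal b).comap (S.chartι K σ) = (chartHypersurfaceι b σ.1).ker := by
  rw [Fan.hypersurfaceIdeal, comap_iInf_of_isOpenImmersion]
  refine le_antisymm ((iInf_le _ σ).trans (comap_ker_comp_self (chartHypersurfaceι b σ.1) _).le)
    (le_iInf fun τ => S.chartHypersurface_compat b hn σ τ)

theorem Fan.exists_isPullback_chart [∀ σ : S.cones, QuasiCompact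
      (chartHypersurfaceι b σ.1 ≫ S.chartι K σ)]
    (hn : ∀ σ ∈ S.cones, ∃ m ∈ latticePoints Δ, σ ≤ normalCone Δ (latticeToReal n m))
    (σ : S.cones) : ∃ f, IsPullback (chartHypersurfaceι b σ.1) f (S.chartι K σ)
      (S.hypersurfaceIdeal b).subschemeι := by
  refine ⟨IsClosedImmersion.lift (S.hypersurfaceIdeal b).subschemeι
    (chartHypersurfaceι b σ.1 ≫ S.chartι K σ) ?_, isPullback_of_isClosedImmersion _ _ _ _ ?_ ?_⟩
  · rw [Scheme.IdealSheafData.ker_subschemeι]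
    exact iInf_le _ σ
  · rw [IsClosedImmersion.lift_fac]
  · rw [Scheme.IdealSheafData.ker_subschemeι, S.comap_hypersurfaceIdeal b hn]

theorem Fan.smooth_hypersurfaceStructureMap
    (hn : ∀ σ ∈ S.cones, ∃ m ∈ latticePoints Δ, σ ≤ normalCone Δ (latticeToReal n m))
    (hs : ∀ σ ∈ S.cones, Algebra.Smooth K (ChartRing K σ ⧸ chartIdeal b σ)) :
    Smooth (S.hypersurfaceStructureMap b) := by
  change AlgebraicGeometry.Smooth ((S.hypersurfaceIdeal b).subschemeι ≫ S.structureMap K)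
  -- The chart rings of the hypersurface are of finite type over `K`, hence noetherian;
  -- quasi-compactness lets kernels commute with restriction to opens.
  have (σ : S.cones) : QuasiCompact (chartHypersurfaceι b σ.1 ≫ S.chartι K σ) := by
    have := hs σ.1 σ.2
    have : IsNoetherianRing (ChartRing K σ.1 ⧸ chartIdeal b σ.1) :=
      Algebra.FiniteType.isNoetherianRing K _
    have : IsLocallyNoetherian
        (Spec (CommRingCat.of (ChartRing K σ.1 ⧸ chartIdeal b σ.1))) := inferInstance
    exact quasiCompact_of_noetherianSpace_source _
  choose f hf using S.exists_isPullback_chart b hn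
  let 𝒰 : (S.toricVariety K).OpenCover := Scheme.IsLocallyDirected.openCover (S.chartDiagram K)
  have : IsZariskiLocalAtSource @AlgebraicGeometry.Smooth.{u} :=
    HasRingHomProperty.instIsZariskiLocalAtSource (Q := RingHom.Smooth)
  refine (IsZariskiLocalAtSource.iff_of_openCover (P := @AlgebraicGeometry.Smooth.{u})
    (𝒰 := 𝒰.pullback₁ (S.hypersurfaceIdeal b).subschemeι)).2 ?_
  intro (σ : S.cones)
  have key : f σ ≫ (S.hypersurfaceIdeal b).subschemeι ≫ S.structureMap K =
      Spec.map (CommRingCat.ofHom (algebraMap K (ChartRing K σ.1 ⧸ chartIdeal b σ.1))) := by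
    rw [← Category.assoc, ← (hf σ).w, Category.assoc,
      S.chartι_structureMap, chartHypersurfaceι, ← Spec.map_comp, ← CommRingCat.ofHom_comp]
  have h1 : AlgebraicGeometry.Smooth (f σ ≫ (S.hypersurfaceIdeal b).subschemeι ≫ S.structureMap K) := by
    rw [key, HasRingHomProperty.Spec_iff (P := @AlgebraicGeometry.Smooth.{u})]
    exact RingHom.smooth_algebraMap.2 (hs σ.1 σ.2)
  have h2 : AlgebraicGeometry.Smooth (((hf σ).flip.isoPullback.inv ≫ f σ) ≫
      (S.hypersurfaceIdeal b).subschemeι ≫ S.structureMap K) := by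
    rw [Category.assoc]
    exact IsZariskiLocalAtSource.comp (P := @AlgebraicGeometry.Smooth.{u}) h1 _
  rw [(hf σ).flip.isoPullback_inv_fst] at h2
  exact h2

end

/-! ### The Jacobian criterion and logarithmic derivations -/

section Jacobian

variable {K R : Type u} [Field K] [CommRing R] [Algebra K R]

/-- The values `D f` form an ideal, since derivations form an `R`-module. By assumption no maximal
ideal contains both it and `f`, so together they generate `1`. -/
theorem exists_derivation_sub_one_mem {f : R}
    (h : ∀ m : Ideal R, m.IsMaximal → f ∈ m → ∃ D : Derivation K R R, D f ∉ m) :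
    ∃ D : Derivation K R R, D f - 1 ∈ Ideal.span {f} := by
  let ev : Derivation K R R →ₗ[R] R :=
    { toFun := fun D => D f
      map_add' := fun _ _ => rfl
      map_smul' := fun _ _ => rfl }
  have htop : LinearMap.range ev ⊔ Ideal.span {f} = (⊤ : Ideal R) := by
    by_contra hne
    obtain ⟨m, hm, hle⟩ := Ideal.exists_le_maximal _ hne
    obtain ⟨D, hD⟩ := h m hm (hle (Ideal.mem_sup_right (Ideal.mem_span_singleton_self f)))
    exact hD (hle (Ideal.mem_sup_left ⟨D, rfl⟩))
  obtain ⟨_, ⟨D, rfl⟩, y, hy, hxy⟩ := Submodule.mem_sup.1 ((Ideal.eq_top_iff_one _).1 htop)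
  refine ⟨D, ?_⟩
  have : D f - 1 = -y := by
    rw [← hxy]; change D f - (D f + y) = -y; ring
  rw [this]
  exact neg_mem hy

/-- A quotient `R/I` of a formally smooth algebra is formally smooth if `R/I² → R/I` splits. Here `r
↦ r - f D r` gives a splitting: it is multiplicative modulo `f²`, and it sends `f` to `-f (D f -
1)`, a multiple of `f²`. -/
theorem smooth_quotient_of_derivation [Algebra.Smooth K R] (f : R) (D : Derivation K R R)
    (hD : D f - 1 ∈ Ideal.span {f}) : Algebra.Smooth K (R ⧸ Ideal.span {f}) where
  finitePresentation := Algebra.FinitePresentation.quotient ⟨{f}, by simp⟩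
  formallySmooth := by
    let π := Ideal.Quotient.mkₐ K (Ideal.span {f})
    let J := RingHom.ker π.toRingHom ^ 2
    have hker : RingHom.ker π.toRingHom = Ideal.span {f} := Ideal.mk_ker
    have hJ : ∀ x, f * f * x ∈ J := fun x => by
      refine Ideal.mul_mem_right _ _ ?_
      change f * f ∈ RingHom.ker π.toRingHom ^ 2
      rw [hker, pow_two]
      exact Ideal.mul_mem_mul (Ideal.mem_span_singleton_self f) (Ideal.mem_span_singleton_self f)
    let φ : R →ₐ[K] R ⧸ J := AlgHom.ofLinearMap
      ((Ideal.Quotient.mkₐ K J).toLinearMap ∘ₗ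
        (LinearMap.id - (LinearMap.mulLeft K f) ∘ₗ D.toLinearMap))
      (by simp) (fun x y => by
        change Ideal.Quotient.mk J (x * y - f * D (x * y)) =
          Ideal.Quotient.mk J (x - f * D x) * Ideal.Quotient.mk J (y - f * D y)
        rw [← map_mul, Ideal.Quotient.eq, D.leibniz, smul_eq_mul, smul_eq_mul]
        convert hJ (-(D x * D y)) using 1
        ring)
    have hφ : ∀ r, φ r = Ideal.Quotient.mk J (r - f * D r) := fun _ => rfl
    refine Algebra.FormallySmooth.of_split π
      (Ideal.Quotient.liftₐ (Ideal.span {f}) φ fun a ha => ?_) ?_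
    · obtain ⟨c, rfl⟩ := Ideal.mem_span_singleton'.1 ha
      obtain ⟨d, hd⟩ := Ideal.mem_span_singleton'.1 hD
      rw [map_mul, hφ f]
      refine mul_eq_zero_of_right _ (Ideal.Quotient.eq_zero_iff_mem.2 ?_)
      convert hJ (-d) using 1
      linear_combination f * hd
    · refine Ideal.Quotient.algHom_ext K ?_
      ext r
      change π (r - f * D r) = π r
      have : π f = 0 := Ideal.Quotient.eq_zero_iff_mem.2 (Ideal.mem_span_singleton_self f)
      rw [map_sub, map_mul, this, zero_mul, sub_zero]

end Jacobian

/-- The logarithmic derivation `z^m ↦ χ(m) z^m`. -/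
def logDerivation {K M : Type*} [Field K] [AddCommMonoid M] (χ : M →+ K) :
    Derivation K (AddMonoidAlgebra K M) (AddMonoidAlgebra K M) :=
  let L : AddMonoidAlgebra K M →ₗ[K] AddMonoidAlgebra K M :=
    { toFun := fun x => x.coeff.sum fun m c => AddMonoidAlgebra.single m (χ m * c)
      map_add' := fun x y => by
        rw [AddMonoidAlgebra.coeff_add, Finsupp.sum_add_index' (by simp)]
        intro m c d
        rw [mul_add, AddMonoidAlgebra.single_add]
      map_smul' := fun a x => by
        rw [AddMonoidAlgebra.coeff_smul, Finsupp.sum_smul_index (by simp), RingHom.id_apply,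
          Finsupp.smul_sum]
        refine Finsupp.sum_congr fun m _ => ?_
        rw [AddMonoidAlgebra.smul_single, smul_eq_mul, mul_left_comm] }
  have hL : ∀ m c, L (AddMonoidAlgebra.single m c) = AddMonoidAlgebra.single m (χ m * c) := by
    intro m c
    change (AddMonoidAlgebra.single m c : AddMonoidAlgebra K M).coeff.sum
      (fun m c => AddMonoidAlgebra.single m (χ m * c)) = _
    rw [AddMonoidAlgebra.coeff_single, Finsupp.sum_single_index (by simp)]
  Derivation.mk' L fun x y => by
    induction x using AddMonoidAlgebra.induction_linear with
    | zero => simp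
    | add x x' hx hx' =>
      simp only [add_mul, map_add, add_smul, smul_add, hx, hx']; abel
    | single m c =>
      induction y using AddMonoidAlgebra.induction_linear with
      | zero => simp
      | add x x' hx hx' =>
        simp only [mul_add, map_add, add_smul, smul_add, hx, hx']; abel
      | single m' c' =>
        rw [AddMonoidAlgebra.single_mul_single, hL, hL, hL, smul_eq_mul, smul_eq_mul,
          AddMonoidAlgebra.single_mul_single, AddMonoidAlgebra.single_mul_single, add_comm m' m,
          ← AddMonoidAlgebra.single_add, map_add]
        congr 1
        ring

theorem logDerivation_single {K M : Type*} [Field K] [AddCommMonoid M] (χ : M →+ K) (m : M)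
    (c : K) : logDerivation χ (AddMonoidAlgebra.single m c) =
      AddMonoidAlgebra.single m (χ m * c) := by
  change (AddMonoidAlgebra.single m c : AddMonoidAlgebra K M).coeff.sum
    (fun m c => AddMonoidAlgebra.single m (χ m * c)) = _
  rw [AddMonoidAlgebra.coeff_single, Finsupp.sum_single_index (by simp)]

/-! ### Coordinates on a smooth cone -/

section SmoothCone

variable {n : ℕ} (e : Module.Basis (Fin n) ℤ (Fin n → ℤ))

/-- The basis of the dual lattice that is dual to `e`. -/
def dualVec (j : Fin n) : Fin n → ℤ := fun i => e.repr (Pi.single i 1) j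

theorem pairing_lattice (m v : Fin n → ℤ) :
    pairing (latticeToReal n m) (latticeToReal n v) = ((m ⬝ᵥ v : ℤ) : ℝ) := by
  simp [pairing, latticeToReal, dotProduct]

theorem dualVec_dotProduct (j : Fin n) (v : Fin n → ℤ) : dualVec e j ⬝ᵥ v = e.repr v j := by
  have h : v = ∑ i, v i • Pi.single i (1 : ℤ) := by
    ext i
    simp [Pi.single_apply]
  conv_rhs => rw [h]
  rw [map_sum, Finsupp.finsetSum_apply]
  refine Finset.sum_congr rfl fun i _ => ?_
  rw [map_smul, Finsupp.smul_apply, smul_eq_mul, mul_comm]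
  rfl

theorem sum_dotProduct_smul_dualVec (m : Fin n → ℤ) : ∑ j, (m ⬝ᵥ e j) • dualVec e j = m := by
  ext i
  have h := congrArg (fun v => m ⬝ᵥ v) (e.sum_repr (Pi.single i 1))
  simp only [dotProduct_sum, dotProduct_smul, dotProduct_single, mul_one, smul_eq_mul] at h
  rw [← h, Finset.sum_apply]
  exact Finset.sum_congr rfl fun j _ => mul_comm _ _

theorem sum_pairing_smul (u : Fin n → ℝ) :
    ∑ j, pairing (latticeToReal n (dualVec e j)) u • latticeToReal n (e j) = u := by
  ext i
  have h : ∀ k, ∑ j, (dualVec e j k : ℝ) * (e j i : ℝ) = if k = i then 1 else 0 := by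
    intro k
    have h1 := congrFun (e.sum_repr (Pi.single k 1)) i
    simp only [Finset.sum_apply, Pi.smul_apply, smul_eq_mul] at h1
    have h2 : ((∑ j, dualVec e j k * e j i : ℤ) : ℝ) = ((Pi.single k 1 : Fin n → ℤ) i : ℤ) := by
      exact_mod_cast h1
    push_cast at h2
    rw [h2, Pi.single_apply]
    simp [eq_comm]
  simp only [pairing, latticeToReal, dotProductBilin_apply_apply, dotProduct, Finset.sum_apply,
    Pi.smul_apply, smul_eq_mul, Finset.sum_mul]
  rw [Finset.sum_comm]
  have : ∀ k, ∑ j, (dualVec e j k : ℝ) * u k * (e j i : ℝ) = (if k = i then 1 else 0) * u k := by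
    intro k
    rw [← h k, Finset.sum_mul]
    exact Finset.sum_congr rfl fun j _ => by ring
  exact (Finset.sum_congr rfl fun k _ => this k).trans (by simp)

theorem mem_hull_iff (J : Set (Fin n)) (u : Fin n → ℝ) :
    u ∈ PointedCone.hull ℝ ((fun j => latticeToReal n (e j)) '' J) ↔
      ∀ j, 0 ≤ pairing (latticeToReal n (dualVec e j)) u ∧
        (j ∉ J → pairing (latticeToReal n (dualVec e j)) u = 0) := by
  classical
  constructor
  · intro hu j
    induction hu using Submodule.span_induction with
    | mem x hx =>
      obtain ⟨i, hi, rfl⟩ := hx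
      simp only
      rw [pairing_lattice, dualVec_dotProduct, e.repr_self, Finsupp.single_apply]
      refine ⟨by split_ifs <;> simp, fun hj => ?_⟩
      rw [if_neg (by rintro rfl; exact hj hi)]
      simp
    | zero => simp
    | add x y _ _ hx hy =>
      rw [map_add]
      exact ⟨add_nonneg hx.1 hy.1, fun hj => by rw [hx.2 hj, hy.2 hj, add_zero]⟩
    | smul a x _ hx =>
      have : pairing (latticeToReal n (dualVec e j)) (a • x)
        = (a : ℝ) * pairing (latticeToReal n (dualVec e j)) x := by
        rw [← smul_eq_mul, ← map_smul]; rfl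
      rw [this]
      exact ⟨mul_nonneg a.2 hx.1, fun hj => by rw [hx.2 hj, mul_zero]⟩
  · intro h
    rw [← sum_pairing_smul e u]
    refine Submodule.sum_mem _ fun j _ => ?_
    by_cases hj : j ∈ J
    · exact Submodule.smul_mem _ (⟨_, (h j).1⟩ : {c : ℝ // 0 ≤ c})
        (PointedCone.subset_hull ⟨j, hj, rfl⟩)
    · rw [(h j).2 hj, zero_smul]
      exact Submodule.zero_mem _

theorem mem_dualMonoid_hull_iff (J : Set (Fin n)) (m : Fin n → ℤ) :
    m ∈ dualMonoid (PointedCone.hull ℝ ((fun j => latticeToReal n (e j)) '' J)) ↔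
      ∀ j ∈ J, 0 ≤ m ⬝ᵥ e j := by
  constructor
  · intro h j hj
    have := h _ (PointedCone.subset_hull ⟨j, hj, rfl⟩)
    simp only at this
    rw [pairing_lattice] at this
    exact_mod_cast this
  · intro h u hu
    have h1 := (mem_hull_iff e J u).1 hu
    rw [← sum_pairing_smul e u, map_sum]
    refine Finset.sum_nonneg fun j _ => ?_
    rw [map_smul, smul_eq_mul]
    by_cases hj : j ∈ J
    · refine mul_nonneg (h1 j).1 ?_
      rw [pairing_lattice]
      exact_mod_cast h j hj
    · rw [(h1 j).2 hj, zero_mul]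

/-- The monoid `σ^∨ ∩ M*` of a cone generated by a basis is free. -/
def dualMonoidEquiv : dualMonoid (PointedCone.hull ℝ
    ((fun j => latticeToReal n (e j)) '' Set.univ)) ≃+ (Fin n →₀ ℕ) where
  toFun m := Finsupp.equivFunOnFinite.symm fun j => (m.1 ⬝ᵥ e j).toNat
  invFun c := ⟨∑ j, (c j : ℤ) • dualVec e j, (mem_dualMonoid_hull_iff e _ _).2 fun j _ => by
    simp only [sum_dotProduct, smul_dotProduct, dualVec_dotProduct, e.repr_self,
      Finsupp.single_apply]
    simp⟩
  left_inv m := by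
    ext1
    have h : ∀ j, ((m.1 ⬝ᵥ e j).toNat : ℤ) = m.1 ⬝ᵥ e j := fun j =>
      Int.toNat_of_nonneg ((mem_dualMonoid_hull_iff e _ _).1 m.2 j trivial)
    simp only [Finsupp.equivFunOnFinite_symm_apply_apply, h]
    exact sum_dotProduct_smul_dualVec e m.1
  right_inv c := by
    ext j
    simp only [Finsupp.equivFunOnFinite_symm_apply_apply, sum_dotProduct, smul_dotProduct,
      dualVec_dotProduct, e.repr_self, Finsupp.single_apply]
    simp
  map_add' m m' := by
    ext j
    have h := (mem_dualMonoid_hull_iff e _ _).1 m.2 j trivial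
    have h' := (mem_dualMonoid_hull_iff e _ _).1 m'.2 j trivial
    simp [add_dotProduct, Int.toNat_add h h']

/-- The cone on the whole basis has a polynomial ring as chart ring. The cone on `J` is a face of
it, so its chart ring is a localization of that polynomial ring. -/
theorem smooth_chartRing (K : Type u) [Field K] (J : Set (Fin n)) :
    Algebra.Smooth K (ChartRing K (PointedCone.hull ℝ ((fun j => latticeToReal n (e j)) '' J))) := by
  classical
  set σ := PointedCone.hull ℝ ((fun j => latticeToReal n (e j)) '' J) with hσ
  set ω := PointedCone.hull ℝ ((fun j => latticeToReal n (e j)) '' Set.univ) with hω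
  have h : σ ≤ ω := Submodule.span_mono (Set.image_mono (Set.subset_univ _))
  have h1 : Algebra.Smooth K (ChartRing K ω) := by
    have e1 : ChartRing K ω ≃ₐ[K] MvPolynomial (Fin n) K :=
      AddMonoidAlgebra.domCongr K K (dualMonoidEquiv e)
    have : Algebra.Smooth K (MvPolynomial (Fin n) K) := { }
    exact Algebra.Smooth.of_equiv e1.symm
  -- On the full cone all dual coordinates are nonnegative, so this sum vanishes exactly where each
  -- coordinate outside `J` does.
  let m : Fin n → ℤ := ∑ j ∈ Finset.univ.filter (· ∉ J), dualVec e j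
  have hm : m ∈ dualMonoid ω := (mem_dualMonoid_hull_iff e _ _).2 fun i _ => by
    rw [sum_dotProduct]
    refine Finset.sum_nonneg fun j _ => ?_
    rw [dualVec_dotProduct, e.repr_self, Finsupp.single_apply]
    split_ifs <;> simp
  have hface : ∀ u, u ∈ σ ↔ u ∈ ω ∧ pairing (latticeToReal n m) u = 0 := by
    intro u
    have hp : pairing (latticeToReal n m) u =
        ∑ j ∈ Finset.univ.filter (· ∉ J), pairing (latticeToReal n (dualVec e j)) u := by
      rw [map_sum, map_sum, LinearMap.sum_apply]
    rw [hσ, hω, mem_hull_iff, mem_hull_iff, hp]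
    constructor
    · intro h
      exact ⟨fun j => ⟨(h j).1, fun hj => absurd trivial hj⟩,
        Finset.sum_eq_zero fun j hj => (h j).2 (Finset.mem_filter.1 hj).2⟩
    · rintro ⟨h2, h3⟩ j
      rw [Finset.sum_eq_zero_iff_of_nonneg fun j _ => (h2 j).1] at h3
      exact ⟨(h2 j).1, fun hj => h3 j (by simp [hj])⟩
  have hs : ω = PointedCone.hull ℝ (latticeToReal n ''
      ((Finset.univ.image e : Finset (Fin n → ℤ)) : Set (Fin n → ℤ))) := by
    rw [hω, Finset.coe_image, Set.image_image, Finset.coe_univ]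
  let _ := (chartRestrict K h).toRingHom.toAlgebra
  have hloc := isLocalization_chart K hs h hm hface
  have : IsScalarTower K (ChartRing K ω) (ChartRing K σ) :=
    IsScalarTower.of_algebraMap_eq fun x => ((chartRestrict K h).commutes x).symm
  have := Algebra.Smooth.of_isLocalization_Away (A := ChartRing K σ)
    (AddMonoidAlgebra.single (⟨m, hm⟩ : dualMonoid ω) (1 : K))
  exact Algebra.Smooth.comp K (ChartRing K ω) (ChartRing K σ)

end SmoothCone

/-! ### Extension of the valuation to an algebraic extension -/

section ValuationExtension

/-- The ring of elements of nonnegative valuation. -/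
def nonnegSubring {K : Type*} [Field K] (val : AddValuation K (WithTop ℝ)) : ValuationSubring K where
  carrier := {x | 0 ≤ val x}
  mul_mem' ha hb := by
    rw [Set.mem_ofPred_eq, val.map_mul]
    exact add_nonneg ha hb
  one_mem' := val.map_one.ge
  add_mem' ha hb := val.map_le_add ha hb
  zero_mem' := by simp
  neg_mem' ha := by rwa [Set.mem_ofPred_eq, val.map_neg]
  mem_or_inv_mem' x := by
    by_cases hx : x = 0
    · left; simp [hx]
    rcases le_total 0 (val x) with h | h
    · exact Or.inl h
    · right
      have h1 : val x + val x⁻¹ = 0 := by rw [← val.map_mul, mul_inv_cancel₀ hx, val.map_one]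
      change 0 ≤ val x⁻¹
      calc 0 = val x + val x⁻¹ := h1.symm
        _ ≤ 0 + val x⁻¹ := by gcongr
        _ = val x⁻¹ := zero_add _

variable {K L : Type*} [Field K] [Field L] [Algebra K L] (val : AddValuation K (WithTop ℝ))

/-- Chevalley's theorem gives a valuation ring of `L` that dominates the valuation ring of `K`. If
`val x < 0` but `x` landed in `A`, then `x⁻¹` would become a unit of `A`, hence be a unit below by
domination. -/
theorem exists_valuationSubring_lying_over : ∃ A : ValuationSubring L,
    ∀ x : K, algebraMap K L x ∈ A ↔ 0 ≤ val x := by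
  obtain ⟨A, h, hloc⟩ := IsLocalRing.exists_factor_valuationRing
    ((algebraMap K L).comp (nonnegSubring val).subtype)
  refine ⟨A, fun x => ⟨fun hx => ?_, fun hx => h ⟨x, hx⟩⟩⟩
  by_contra hneg
  have hx0 : x ≠ 0 := by rintro rfl; simp at hneg
  have hinv : x⁻¹ ∈ nonnegSubring val := ((nonnegSubring val).mem_or_inv_mem x).resolve_left hneg
  have hu : IsUnit (⟨x⁻¹, hinv⟩ : nonnegSubring val) := by
    refine hloc.map_nonunit _ (IsUnit.of_mul_eq_one (⟨algebraMap K L x, hx⟩ : A) ?_)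
    ext
    change algebraMap K L x⁻¹ * algebraMap K L x = 1
    rw [← map_mul, inv_mul_cancel₀ hx0, map_one]
  obtain ⟨y, hy⟩ := hu.exists_right_inv
  have hy' : x⁻¹ * (y : K) = 1 := congrArg Subtype.val hy
  have : x = y := by field_simp at hy'; exact hy'.symm
  exact hneg (this ▸ y.2)

/-- In a vanishing polynomial expression in `y`, at least two terms attain the maximal
multiplicative valuation. Comparing them expresses a power of the valuation of `y` by a valuation
from `K`. -/
theorem exists_pow_valuation_eq [Algebra.IsAlgebraic K L] (A : ValuationSubring L) {y : L}
    (hy : y ≠ 0) : ∃ n : ℕ, 0 < n ∧ ∃ a : K, a ≠ 0 ∧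
      A.valuation y ^ n = A.valuation (algebraMap K L a) := by
  obtain ⟨p, hp, hpy⟩ := Algebra.IsAlgebraic.isAlgebraic (R := K) y
  let f : ℕ → L := fun i => algebraMap K L (p.coeff i) * y ^ i
  have hsum : ∑ i ∈ p.support, f i = 0 := by
    rw [← hpy, Polynomial.aeval_def, Polynomial.eval₂_eq_sum, Polynomial.sum_def]
  obtain ⟨i, hi, hmax⟩ := p.support.exists_max_image (fun i => A.valuation (f i))
    (Polynomial.support_nonempty.2 hp)
  have hne : ∀ i ∈ p.support, f i ≠ 0 := fun i hi => mul_ne_zero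
    ((map_ne_zero _).2 (Polynomial.mem_support_iff.1 hi)) (pow_ne_zero _ hy)
  obtain ⟨j, hj, hji, hval⟩ : ∃ j ∈ p.support, j ≠ i ∧ A.valuation (f j) = A.valuation (f i) := by
    by_contra! hcon
    have := A.valuation.map_sum_eq_of_lt hi fun j hj => by
      rw [Finset.mem_sdiff, Finset.mem_singleton] at hj
      exact lt_of_le_of_ne (hmax j hj.1) (hcon j hj.1 hj.2)
    rw [hsum, map_zero] at this
    exact hne i hi ((map_eq_zero _).1 this.symm)
  have key : ∀ i ∈ p.support, ∀ j ∈ p.support, i < j → A.valuation (f j) = A.valuation (f i) →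
      ∃ n : ℕ, 0 < n ∧ ∃ a : K, a ≠ 0 ∧ A.valuation y ^ n = A.valuation (algebraMap K L a) := by
    intro i hi j hj hij hval
    have hi' := Polynomial.mem_support_iff.1 hi
    have hj' := Polynomial.mem_support_iff.1 hj
    refine ⟨j - i, by omega, p.coeff i / p.coeff j, div_ne_zero hi' hj', ?_⟩
    have h1 : A.valuation (algebraMap K L (p.coeff j)) ≠ 0 := by simpa using hj'
    have h2 : A.valuation y ^ i ≠ 0 := pow_ne_zero _ (by simpa using hy)
    simp only [f, map_mul, map_pow] at hval
    rw [map_div₀, map_div₀, eq_div_iff h1]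
    refine mul_right_cancel₀ h2 ?_
    rw [← hval, show j = j - i + i by omega, pow_add, Nat.add_sub_cancel]
    ac_rfl
  rcases lt_or_gt_of_ne hji with h | h
  · exact key j hj i hi h hval.symm
  · exact key i hi j hj h hval

theorem exists_addValuation_extension [Algebra.IsAlgebraic K L] :
    ∃ w : AddValuation L (WithTop ℝ), ∀ x, w (algebraMap K L x) = val x := by
  classical
  obtain ⟨A, hA⟩ := exists_valuationSubring_lying_over (L := L) val
  have hle : ∀ x y : K, y ≠ 0 →
      A.valuation (algebraMap K L x) ≤ A.valuation (algebraMap K L y) → val y ≤ val x := by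
    intro x y hy h
    have hy' : A.valuation (algebraMap K L y) ≠ 0 := by simpa using hy
    have h1 : A.valuation (algebraMap K L (x / y)) ≤ 1 := by
      rw [map_div₀, map_div₀]
      exact div_le_one_of_le₀ h zero_le
    have h2 := (hA _).1 ((A.valuation_le_one_iff _).1 h1)
    calc val y = 0 + val y := (zero_add _).symm
      _ ≤ val (x / y) + val y := by gcongr
      _ = val x := by rw [← val.map_mul, div_mul_cancel₀ _ hy]
  -- `Rel y r` says that `r` is a possible value at `y`: as `y ^ n` has the `A`-valuation of `a`,
  -- the extension must be `val a / n`. Monotonicity (`hmono`) makes `r` unique and gives the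
  -- ultrametric inequality.
  let Rel : L → ℝ → Prop := fun y r => ∃ n : ℕ, 0 < n ∧ ∃ a : K, a ≠ 0 ∧
    A.valuation y ^ n = A.valuation (algebraMap K L a) ∧ val a = ((n * r : ℝ) : WithTop ℝ)
  have hex : ∀ y : L, y ≠ 0 → ∃ r, Rel y r := by
    intro y hy
    obtain ⟨n, hn, a, ha, h⟩ := exists_pow_valuation_eq (K := K) A hy
    obtain ⟨s, hs⟩ := WithTop.ne_top_iff_exists.1 (val.ne_top_iff.2 ha)
    refine ⟨s / n, n, hn, a, ha, h, ?_⟩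
    rw [← hs, mul_div_cancel₀]
    exact_mod_cast hn.ne'
  have hmono : ∀ x y r s, Rel x r → Rel y s → A.valuation x ≤ A.valuation y → s ≤ r := by
    rintro x y r s ⟨n, hn, a, ha, hxa, hr⟩ ⟨m, hm, b, hb, hyb, hs⟩ hxy
    have h1 : A.valuation (algebraMap K L (a ^ m)) ≤ A.valuation (algebraMap K L (b ^ n)) := by
      rw [map_pow, map_pow, map_pow, map_pow, ← hxa, ← hyb, ← pow_mul, ← pow_mul, mul_comm m n]
      exact pow_le_pow_left₀ zero_le hxy _
    have h2 := hle _ _ (pow_ne_zero _ hb) h1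
    rw [val.map_pow, val.map_pow, hr, hs, ← WithTop.coe_nsmul, ← WithTop.coe_nsmul,
      WithTop.coe_le_coe, nsmul_eq_mul, nsmul_eq_mul] at h2
    have hn' : (0 : ℝ) < n := by exact_mod_cast hn
    have hm' : (0 : ℝ) < m := by exact_mod_cast hm
    have h3 : (n * m : ℝ) * s ≤ (n * m : ℝ) * r := by linarith
    exact le_of_mul_le_mul_left h3 (by positivity)
  have hmul : ∀ x y r s, Rel x r → Rel y s → Rel (x * y) (r + s) := by
    rintro x y r s ⟨n, hn, a, ha, hxa, hr⟩ ⟨m, hm, b, hb, hyb, hs⟩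
    refine ⟨n * m, Nat.mul_pos hn hm, a ^ m * b ^ n,
      mul_ne_zero (pow_ne_zero _ ha) (pow_ne_zero _ hb), ?_, ?_⟩
    · rw [map_mul, map_mul, map_mul, map_pow, map_pow, map_pow, map_pow, ← hxa, ← hyb, ← pow_mul,
        ← pow_mul, mul_comm m n, mul_pow]
    · rw [val.map_mul, val.map_pow, val.map_pow, hr, hs, ← WithTop.coe_nsmul, ← WithTop.coe_nsmul,
        ← WithTop.coe_add, nsmul_eq_mul, nsmul_eq_mul]
      congr 1
      push_cast
      ring
  choose! ρ hρ using hex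
  have huniq : ∀ x r, x ≠ 0 → Rel x r → ρ x = r := fun x r hx hr =>
    le_antisymm (hmono _ _ _ _ hr (hρ x hx) le_rfl) (hmono _ _ _ _ (hρ x hx) hr le_rfl)
  have hbase : ∀ x : K, x ≠ 0 → val x = (ρ (algebraMap K L x) : WithTop ℝ) := by
    intro x hx
    obtain ⟨s, hs⟩ := WithTop.ne_top_iff_exists.1 (val.ne_top_iff.2 hx)
    rw [huniq (algebraMap K L x) s (by simpa using hx) ⟨1, one_pos, x, hx, by simp, by simp [← hs]⟩,
      hs]
  refine ⟨AddValuation.of (fun x => if x = 0 then ⊤ else (ρ x : WithTop ℝ)) (by simp) ?_ ?_ ?_, ?_⟩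
  · have := hbase 1 one_ne_zero
    rw [val.map_one, map_one] at this
    simp [← this]
  · intro x y
    by_cases hx : x = 0
    · simp [hx]
    by_cases hy : y = 0
    · simp [hy]
    by_cases hxy : x + y = 0
    · simp [hxy]
    simp only [hx, hy, hxy, if_false]
    rcases le_total (A.valuation x) (A.valuation y) with h | h
    · have := (A.valuation.map_add x y).trans_eq (max_eq_right h)
      exact (min_le_right _ _).trans
        (WithTop.coe_le_coe.2 (hmono _ _ _ _ (hρ _ hxy) (hρ _ hy) this))
    · have := (A.valuation.map_add x y).trans_eq (max_eq_left h)
      exact (min_le_left _ _).trans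
        (WithTop.coe_le_coe.2 (hmono _ _ _ _ (hρ _ hxy) (hρ _ hx) this))
  · intro x y
    by_cases hx : x = 0
    · simp [hx]
    by_cases hy : y = 0
    · simp [hy]
    simp only [hx, hy, mul_eq_zero, or_self, if_false]
    rw [huniq _ _ (mul_ne_zero hx hy) (hmul _ _ _ _ (hρ x hx) (hρ y hy)), WithTop.coe_add]
  · intro x
    rw [AddValuation.of_apply]
    by_cases hx : x = 0
    · simp [hx]
    · rw [if_neg (by simpa using hx), hbase x hx]

end ValuationExtension

/-! ### Domains of linearity and supporting affine functions -/

section Convex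

variable {n : ℕ} {Δ : Set (Fin n → ℝ)}

theorem exists_linearityDomain_superset {ψ : (Fin n → ℝ) → ℝ} {E : Set (Fin n → ℝ)}
    (hne : E.Nonempty) (hΔ : E ⊆ Δ) (hconv : Convex ℝ E)
    (haff : ∃ l : (Fin n → ℝ) →ᵃ[ℝ] ℝ, ∀ x ∈ E, ψ x = l x) :
    ∃ D, IsLinearityDomain Δ ψ D ∧ E ⊆ D := by
  let P : Set (Fin n → ℝ) → Prop := fun F =>
    F ⊆ Δ ∧ Convex ℝ F ∧ ∃ l : (Fin n → ℝ) →ᵃ[ℝ] ℝ, ∀ x ∈ F, ψ x = l x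
  obtain ⟨D, hED, hD⟩ := zorn_subset_nonempty {F | P F ∧ E ⊆ F} (by
    intro c hc hchain hcne
    -- For Zorn's lemma, the union of a chain must carry one affine function. Take a member `F₀`
    -- whose affine span has maximal dimension: every larger member has the same span, so its affine
    -- function agrees there with that of `F₀`.
    let r : Set (Fin n → ℝ) → ℕ := fun F => Module.finrank ℝ (affineSpan ℝ F).direction
    have hbdd : BddAbove (r '' c) := ⟨Module.finrank ℝ (Fin n → ℝ), by
      rintro _ ⟨F, _, rfl⟩
      exact Submodule.finrank_le _⟩
    obtain ⟨F₀, hF₀, hr⟩ := Nat.sSup_mem (hcne.image r) hbdd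
    have hmax : ∀ F ∈ c, r F ≤ r F₀ := fun F hF => hr ▸ le_csSup hbdd ⟨F, hF, rfl⟩
    obtain ⟨l, hl⟩ := (hc hF₀).1.2.2
    refine ⟨⋃₀ c, ⟨⟨Set.sUnion_subset fun F hF => (hc hF).1.1,
      hchain.directedOn.convex_sUnion fun {F} hF => (hc hF).1.2.1, l, ?_⟩,
      (hc hF₀).2.trans (Set.subset_sUnion_of_mem hF₀)⟩, fun F hF => Set.subset_sUnion_of_mem hF⟩
    rintro x ⟨F, hF, hx⟩
    rcases hchain.total hF hF₀ with h | h
    · exact hl x (h hx)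
    · obtain ⟨l', hl'⟩ := (hc hF).1.2.2
      have hle : affineSpan ℝ F₀ ≤ affineSpan ℝ F := affineSpan_mono ℝ h
      have hne₀ : (affineSpan ℝ F₀ : Set (Fin n → ℝ)).Nonempty :=
        (hne.mono (hc hF₀).2).affineSpan ℝ
      have heq : affineSpan ℝ F₀ = affineSpan ℝ F :=
        AffineSubspace.eq_of_direction_eq_of_nonempty_of_le
          (Submodule.eq_of_le_of_finrank_le (AffineSubspace.direction_le hle) (hmax F hF)) hne₀ hle
      have hll : Set.EqOn l' l (affineSpan ℝ F₀) := by
        refine AffineMap.eqOn_affineSpan fun y hy => ?_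
        rw [← hl y hy, ← hl' y (h hy)]
      rw [hl' x hx]
      exact hll (heq ▸ subset_affineSpan ℝ F hx)) E ⟨⟨hΔ, hconv, haff⟩, le_rfl⟩
  exact ⟨D, ⟨hD.1.1, fun F hF hDF => hD.2 ⟨hF, hED.trans hDF⟩ hDF⟩, hED⟩

/-- On the convex hull of `A` the upper hull equals `g`: `g` is itself an admissible concave
function, and any other admissible one is at least `g` on `A`, hence on the hull by concavity. -/
theorem exists_linearityDomain_of_support (hΔ : Convex ℝ Δ) {v : latticePoints Δ → WithTop ℝ}
    (g : (Fin n → ℝ) →ᵃ[ℝ] ℝ)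
    (hg : ∀ p, ((-(g (latticeToReal n p.1)) : ℝ) : WithTop ℝ) ≤ v p)
    {A : Set (latticePoints Δ)} (hA : A.Nonempty)
    (hgA : ∀ p ∈ A, v p = ((-(g (latticeToReal n p.1)) : ℝ) : WithTop ℝ)) :
    ∃ D, IsLinearityDomain Δ (upperHull Δ v) D ∧ ∀ p ∈ A, latticeToReal n p.1 ∈ D := by
  let E : Set (Fin n → ℝ) := convexHull ℝ ((fun p : latticePoints Δ => latticeToReal n p.1) '' A)
  have hEΔ : E ⊆ Δ := convexHull_min (by rintro _ ⟨p, _, rfl⟩; exact p.2) hΔ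
  have hsub : (fun p : latticePoints Δ => latticeToReal n p.1) '' A ⊆ E := subset_convexHull ℝ _
  have hconcave : ConcaveOn ℝ Δ g :=
    ((concaveOn_id convex_univ).comp_affineMap g).subset (fun _ _ => trivial) hΔ
  have hconvex : ConvexOn ℝ Δ g :=
    ((convexOn_id convex_univ).comp_affineMap g).subset (fun _ _ => trivial) hΔ
  have hψ : ∀ x ∈ E, upperHull Δ v x = g x := by
    intro x hx
    have hlower : ∀ r ∈ {r | ∃ h : (Fin n → ℝ) → ℝ, ConcaveOn ℝ Δ h ∧
        (∀ p : latticePoints Δ, ((-(h (latticeToReal n p.1)) : ℝ) : WithTop ℝ) ≤ v p) ∧ h x = r},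
        g x ≤ r := by
      rintro _ ⟨h, hh, hhv, rfl⟩
      have hc := (hh.sub hconvex).convex_ge 0
      have : E ⊆ {x | x ∈ Δ ∧ 0 ≤ (h - g) x} := by
        refine convexHull_min ?_ hc
        rintro _ ⟨p, hp, rfl⟩
        have h1 := hhv p
        rw [hgA p hp, WithTop.coe_le_coe] at h1
        exact ⟨p.2, sub_nonneg.2 (neg_le_neg_iff.1 h1)⟩
      exact sub_nonneg.1 (this hx).2
    exact le_antisymm (csInf_le ⟨g x, hlower⟩ ⟨g, hconcave, hg, rfl⟩)
      (le_csInf ⟨g x, g, hconcave, hg, rfl⟩ hlower)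
  obtain ⟨D, hD, hED⟩ := exists_linearityDomain_superset ((hA.image _).mono hsub) hEΔ
    (convex_convexHull ℝ _) ⟨g, hψ⟩
  exact ⟨D, hD, fun p hp => hED (hsub ⟨p, hp, rfl⟩)⟩

end Convex

/-! ### Integral covectors of a lattice simplex -/

section Lattice

/-- The barycentric coordinate of the vertex `q j` is integral on the lattice `H` spanned by the
edges `q i - q 0`. Its multiple by the index `N` is integral on the saturation `Λ` of `H`, and it
extends to all of `ℤⁿ` because `Λ` is a direct summand. -/
theorem exists_coordinate {n d : ℕ} (q : Fin (d + 1) → Fin n → ℤ)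
    (hq : AffineIndependent ℝ (fun i => latticeToReal n (q i)))  {j : Fin (d + 1)} (hj : j ≠ 0) :
    ∃ u : Fin n → ℤ, ∀ i, (q i - q 0) ⬝ᵥ u = if i = j then (normalizedVolume q : ℤ) else 0 := by
  let V : Fin (d + 1) → Fin n → ℝ := fun i => latticeToReal n (q i - q 0)
  let Λ : AddSubgroup (Fin n → ℤ) :=
    (Submodule.span ℝ (Set.range V)).toAddSubgroup.comap (latticeToReal n)
  let H : AddSubgroup (Fin n → ℤ) := AddSubgroup.closure (Set.range fun i => q i - q 0)
  set N := normalizedVolume q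
  have hNH : ∀ x ∈ Λ, N • x ∈ H := fun x hx =>
    (H.addSubgroupOf Λ).nsmul_index_mem (⟨x, hx⟩ : Λ)
  have hqΛ : ∀ i, q i - q 0 ∈ Λ := fun i => Submodule.subset_span ⟨i, rfl⟩
  obtain ⟨φ, hφ⟩ : ∃ φ : (Fin n → ℝ) →ₗ[ℝ] ℝ, ∀ i, φ (V i) = if i = j then 1 else 0 := by
    have hli := (affineIndependent_iff_linearIndependent_vsub ℝ _ 0).1 hq
    obtain ⟨g, hg⟩ := LinearMap.exists_leftInverse_of_injective _ (LinearMap.ker_eq_bot.2 hli)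
    refine ⟨Finsupp.lapply ⟨j, hj⟩ ∘ₗ g, fun i => ?_⟩
    by_cases hi : i = 0
    · subst hi
      simp [V, hj.symm]
    · have := DFunLike.congr_fun hg (Finsupp.single ⟨i, hi⟩ 1)
      rw [LinearMap.comp_apply, Finsupp.linearCombination_single, one_smul, vsub_eq_sub,
        ← map_sub] at this
      rw [LinearMap.comp_apply]
      change (g (latticeToReal n (q i - q 0))) _ = _
      rw [this, LinearMap.id_apply, Finsupp.single_apply]
      simp
  have hφH : ∀ x ∈ H, ∃ a : ℤ, (a : ℝ) = φ (latticeToReal n x) := by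
    intro x hx
    induction hx using AddSubgroup.closure_induction with
    | mem x hx =>
      obtain ⟨i, rfl⟩ := hx
      exact ⟨if i = j then 1 else 0, by rw [show φ (latticeToReal n (q i - q 0)) = _ from hφ i]; simp⟩
    | zero => exact ⟨0, by simp⟩
    | add x y _ _ hx hy =>
      obtain ⟨a, ha⟩ := hx
      obtain ⟨b, hb⟩ := hy
      exact ⟨a + b, by simp [ha, hb]⟩
    | neg x _ hx =>
      obtain ⟨a, ha⟩ := hx
      exact ⟨-a, by simp [ha]⟩
  let Λ' : Submodule ℤ (Fin n → ℤ) := AddSubgroup.toIntSubmodule Λ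
  have hφΛ : ∀ x : Λ', ∃ a : ℤ, (a : ℝ) = N * φ (latticeToReal n x) := by
    intro x
    obtain ⟨a, ha⟩ := hφH _ (hNH x.1 x.2)
    exact ⟨a, by rw [ha, map_nsmul, map_nsmul, nsmul_eq_mul]⟩
  choose a ha using hφΛ
  let α : Λ' →+ ℤ :=
    { toFun := a
      map_zero' := by
        have := ha 0
        simpa using this
      map_add' := fun x y => by
        have : (a (x + y) : ℝ) = ((a x + a y : ℤ) : ℝ) := by
          push_cast
          rw [ha, ha, ha, Submodule.coe_add, map_add, map_add, mul_add]
        exact_mod_cast this }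
  -- `Λ` is the intersection of `ℤⁿ` with a real subspace, so the quotient is torsion-free and thus
  -- free; a section `s` of the projection then splits off `Λ`.
  have htf : Module.IsTorsionFree ℤ ((Fin n → ℤ) ⧸ Λ') := by
    refine Module.IsTorsionFree.of_smul_eq_zero fun k x hkx => ?_
    obtain ⟨y, rfl⟩ := Λ'.mkQ_surjective x
    refine or_iff_not_imp_left.2 fun hk => ?_
    have h1 : k • y ∈ Λ := by
      rw [← map_smul] at hkx
      exact (Submodule.Quotient.mk_eq_zero Λ').1 hkx
    refine (Submodule.Quotient.mk_eq_zero Λ').2 ?_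
    change latticeToReal n y ∈ Submodule.span ℝ (Set.range V)
    have h2 : (k : ℝ) • latticeToReal n y ∈ Submodule.span ℝ (Set.range V) := by
      rw [Int.cast_smul_eq_zsmul, ← map_zsmul]
      exact h1
    exact (Submodule.smul_mem_iff _ (Int.cast_ne_zero.2 hk)).1 h2
  have : Module.Free ℤ ((Fin n → ℤ) ⧸ Λ') := inferInstance
  obtain ⟨s, hs⟩ := Module.projective_lifting_property Λ'.mkQ LinearMap.id Λ'.mkQ_surjective
  have hπ : ∀ x, x - s (Λ'.mkQ x) ∈ Λ' := fun x => by
    refine (Submodule.Quotient.mk_eq_zero Λ').1 ?_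
    change Λ'.mkQ _ = 0
    rw [map_sub]
    have := DFunLike.congr_fun hs (Λ'.mkQ x)
    rw [LinearMap.comp_apply, LinearMap.id_apply] at this
    rw [this, sub_self]
  let β : (Fin n → ℤ) →ₗ[ℤ] ℤ := α.toIntLinearMap ∘ₗ
    (LinearMap.id - s ∘ₗ Λ'.mkQ).codRestrict Λ' hπ
  refine ⟨fun k => β (Pi.single k 1), fun i => ?_⟩
  have h1 : ∀ x, x ⬝ᵥ (fun k => β (Pi.single k 1)) = β x := by
    intro x
    have h : x = ∑ i, x i • Pi.single i (1 : ℤ) := by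
      ext i
      simp [Pi.single_apply]
    conv_rhs => rw [h]
    rw [map_sum]
    exact Finset.sum_congr rfl fun i _ => (map_smul β _ _).symm
  rw [h1]
  have h2 : Λ'.mkQ (q i - q 0) = 0 := (Submodule.Quotient.mk_eq_zero _).2 (hqΛ i)
  have h3 : (LinearMap.id - s ∘ₗ Λ'.mkQ).codRestrict Λ' hπ (q i - q 0) = ⟨q i - q 0, hqΛ i⟩ := by
    ext1
    change q i - q 0 - s (Λ'.mkQ (q i - q 0)) = _
    rw [h2, map_zero, sub_zero]
  change a ((LinearMap.id - s ∘ₗ Λ'.mkQ).codRestrict Λ' hπ (q i - q 0)) = _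
  rw [h3]
  have h4 := ha ⟨q i - q 0, hqΛ i⟩
  rw [show φ (latticeToReal n (q i - q 0)) = _ from hφ i] at h4
  split_ifs at h4 ⊢
  · rw [mul_one] at h4
    exact_mod_cast h4
  · rw [mul_zero] at h4
    exact_mod_cast h4

end Lattice

/-! ### The tropical argument at a singular point -/

section Core

variable {K : Type u} [Field K] {n : ℕ}

theorem sum_ne_zero_of_forall_lt {L ι : Type*} [Field L] (w : AddValuation L (WithTop ℝ))
    {s : Finset ι} {f : ι → L} {i : ι} {c : ℝ} (hi : i ∈ s) (hc : w (f i) = c)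
    (h : ∀ j ∈ s, j ≠ i → (c : WithTop ℝ) < w (f j)) : ∑ j ∈ s, f j ≠ 0 := by
  classical
  intro h0
  rw [← Finset.add_sum_erase _ _ hi] at h0
  have h1 := w.map_lt_sum' (s := s.erase i) (f := f) (WithTop.coe_lt_top c)
    fun j hj => h j (Finset.mem_of_mem_erase hj) (Finset.ne_of_mem_erase hj)
  rw [eq_neg_of_add_eq_zero_right h0, w.map_neg, hc] at h1
  exact h1.false

/-- `T p` stands for the value of `z^(p - p₀)` at an `L`-point; `hsum` and `hsum'` say that the
equation and its logarithmic derivatives vanish there. The contradiction comes from a sum with a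
unique term of least valuation. -/
theorem tropical_regularity {L : Type*} [Field L] [Algebra K L] {val : AddValuation K (WithTop ℝ)}
    (hval : ∀ m : ℤ, (m : K) ≠ 0 → val (m : K) = 0) {w : AddValuation L (WithTop ℝ)}
    (hw : ∀ x, w (algebraMap K L x) = val x) {Δ : Set (Fin n → ℝ)} (hΔ : Convex ℝ Δ)
    (b : latticePoints Δ →₀ K)
    (hsub : InducesGoodSubdivision Δ (fun p => val (b p)) (ringChar K))
    (p₀ : latticePoints Δ) (hb : b p₀ ≠ 0) (T : latticePoints Δ → L) (hT₀ : T p₀ ≠ 0)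
    (ν h : (Fin n → ℝ) →ₗ[ℝ] ℝ)
    (hT : ∀ p, T p ≠ 0 → w (T p) = (ν (latticeToReal n (p.1 - p₀.1)) : WithTop ℝ) ∧
      h (latticeToReal n (p.1 - p₀.1)) = 0)
    (hT' : ∀ p, T p = 0 → 0 < h (latticeToReal n (p.1 - p₀.1)))
    (hsum : ∑ p ∈ b.support, algebraMap K L (b p) * T p = 0)
    (hsum' : ∀ u : Fin n → ℤ, ∑ p ∈ b.support,
      (((p.1 - p₀.1) ⬝ᵥ u : ℤ) : L) * (algebraMap K L (b p) * T p) = 0) : False := by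
  classical
  let F : latticePoints Δ → L := fun p => algebraMap K L (b p) * T p
  obtain ⟨a, haS, hmin⟩ := (b.support.filter (T · ≠ 0)).exists_min_image (fun p => w (F p))
    ⟨p₀, Finset.mem_filter.2 ⟨Finsupp.mem_support_iff.2 hb, hT₀⟩⟩
  rw [Finset.mem_filter, Finsupp.mem_support_iff] at haS
  obtain ⟨c, hc⟩ := WithTop.ne_top_iff_exists.1 (w.ne_top_iff.2
    (mul_ne_zero ((map_ne_zero (algebraMap K L)).2 haS.1) haS.2))
  have hcF : ∀ p, (c : WithTop ℝ) ≤ w (F p) := by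
    intro p
    by_cases h0 : F p = 0
    · simp [h0]
    · rw [hc]
      refine hmin p (Finset.mem_filter.2 ⟨Finsupp.mem_support_iff.2 ?_, right_ne_zero_of_mul h0⟩)
      exact (map_ne_zero (algebraMap K L)).1 (left_ne_zero_of_mul h0)
  let A : Set (latticePoints Δ) := {p | w (F p) = c}
  have haA : a ∈ A := hc.symm
  let δ : latticePoints Δ → Fin n → ℝ := fun p => latticeToReal n (p.1 - p₀.1)
  -- `C` bounds the slopes needed to lift `g` above `-v` at the finitely many support points where
  -- the monomial vanishes. There `h` is positive, so a large multiple of `h` suffices; it changes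
  -- nothing where the monomial is non-zero.
  obtain ⟨C, hC⟩ : ∃ C : ℝ, ∀ p ∈ b.support.filter (T · = 0),
      (c - ν (δ p) - (val (b p)).untopD 0) / h (δ p) ≤ C := by
    obtain ⟨C, hC⟩ := ((b.support.filter (T · = 0)).image fun p =>
      (c - ν (δ p) - (val (b p)).untopD 0) / h (δ p)).exists_le
    exact ⟨C, fun p hp => hC _ (Finset.mem_image_of_mem _ hp)⟩
  let g : (Fin n → ℝ) →ᵃ[ℝ] ℝ := (ν + C • h).toAffineMap +
    AffineMap.const ℝ _ (-(ν + C • h) (latticeToReal n p₀.1) - c)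
  have hgp : ∀ p : latticePoints Δ, g (latticeToReal n p.1) = ν (δ p) + C * h (δ p) - c := by
    intro p
    simp only [g, δ, map_sub, AffineMap.coe_add, Pi.add_apply, LinearMap.coe_toAffineMap,
      AffineMap.const_apply, LinearMap.add_apply, LinearMap.smul_apply, smul_eq_mul]
    ring
  have hb_real : ∀ p, b p ≠ 0 → ∃ r : ℝ, val (b p) = r := fun p hp =>
    (WithTop.ne_top_iff_exists.1 (val.ne_top_iff.2 hp)).imp fun _ h => h.symm
  have hwF : ∀ p, w (F p) = val (b p) + w (T p) := fun p => by rw [w.map_mul, hw]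
  obtain ⟨D, hD, hAD⟩ := exists_linearityDomain_of_support hΔ (v := fun p => val (b p)) g
    (fun p => by
      by_cases hbp : b p = 0
      · simp [hbp]
      obtain ⟨r, hr⟩ := hb_real p hbp
      rw [hr, WithTop.coe_le_coe, hgp]
      by_cases hTp : T p = 0
      · have h1 := hC p (Finset.mem_filter.2 ⟨Finsupp.mem_support_iff.2 hbp, hTp⟩)
        have h2 : 0 < h (δ p) := hT' p hTp
        rw [hr, WithTop.untopD_coe, div_le_iff₀ h2] at h1
        linarith
      · have h1 := hcF p
        rw [hwF, hr, (hT p hTp).1, ← WithTop.coe_add, WithTop.coe_le_coe] at h1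
        have h2 : h (δ p) = 0 := (hT p hTp).2
        rw [h2]
        change c ≤ r + ν (δ p) at h1
        linarith) (A := A) ⟨a, haA⟩ (fun p hp => by
      have hp' : w (F p) = c := hp
      have hF0 : F p ≠ 0 := w.ne_top_iff.1 (by rw [hp']; exact WithTop.coe_ne_top)
      have hTp : T p ≠ 0 := right_ne_zero_of_mul hF0
      obtain ⟨r, hr⟩ := hb_real p ((map_ne_zero (algebraMap K L)).1 (left_ne_zero_of_mul hF0))
      have h2 : h (δ p) = 0 := (hT p hTp).2
      rw [hwF, hr, (hT p hTp).1, ← WithTop.coe_add, WithTop.coe_inj] at hp'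
      change r + ν (δ p) = c at hp'
      change val (b p) = _
      rw [hr, WithTop.coe_inj, hgp, h2]
      linarith)
  obtain ⟨d, q, hq, -, hDq, hN⟩ := hsub D hD
  set N := normalizedVolume q with hNdef
  have hA_supp : ∀ p ∈ A, p ∈ b.support := fun p hp => by
    have hF0 : F p ≠ 0 := w.ne_top_iff.1 (by rw [show w (F p) = c from hp]; exact WithTop.coe_ne_top)
    exact Finsupp.mem_support_iff.2 ((map_ne_zero (algebraMap K L)).1 (left_ne_zero_of_mul hF0))
  have hlt : ∀ p, p ∉ A → (c : WithTop ℝ) < w (F p) := fun p hp =>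
    lt_of_le_of_ne (hcF p) (fun h => hp h.symm)
  have hint : ∀ m : ℤ, 0 ≤ w (m : L) := fun m => by
    by_cases hm : (m : K) = 0
    · rw [← map_intCast (algebraMap K L), hm]; simp
    · rw [← map_intCast (algebraMap K L), hw, hval m hm]
  have hwN : w ((N : ℤ) : L) = 0 := by
    have : ((N : ℤ) : K) ≠ 0 := by
      rw [Int.cast_natCast]
      exact fun h => hN ((ringChar.spec K N).1 h)
    rw [← map_intCast (algebraMap K L), hw, hval _ this]
  by_cases hcase : ∃ p ∈ A, p.1 ≠ q 0
  · obtain ⟨p, hpA, hpq⟩ := hcase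
    obtain ⟨j, hj⟩ := hDq (hAD p hpA)
    have hj0 : j ≠ 0 := by rintro rfl; exact hpq hj.symm
    obtain ⟨u, hu⟩ := exists_coordinate q hq hj0
    -- Among the points of `A`, the covector `u` keeps only `p = q j`, with coefficient `N` of
    -- valuation `0`. Outside `A` the terms already have valuation above `c`, and integer
    -- coefficients cannot lower it.
    refine sum_ne_zero_of_forall_lt w (s := b.support) (i := p) (c := c)
      (f := fun p => (((p.1 - q 0) ⬝ᵥ u : ℤ) : L) * F p) (hA_supp p hpA) ?_ (fun p' _ hne => ?_) ?_
    · rw [← hj, hu j, if_pos rfl, w.map_mul, hwN, zero_add]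
      exact hpA
    · by_cases hp' : p' ∈ A
      · obtain ⟨i, hi⟩ := hDq (hAD p' hp')
        have hij : i ≠ j := by
          rintro rfl
          exact hne (Subtype.ext (hi.symm.trans hj))
        rw [← hi, hu i, if_neg hij]
        simp
      · rw [w.map_mul]
        exact (hlt p' hp').trans_le (le_add_of_nonneg_left (hint _))
    -- Moving the base point from `p₀` to `q 0` adds a constant multiple of `∑ F p`, which is zero.
    · have h1 : ∀ p : latticePoints Δ, (((p.1 - q 0) ⬝ᵥ u : ℤ) : L) * F p =
          (((p.1 - p₀.1) ⬝ᵥ u : ℤ) : L) * F p + (((p₀.1 - q 0) ⬝ᵥ u : ℤ) : L) * F p := by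
        intro p
        rw [← add_mul, ← Int.cast_add, ← add_dotProduct, sub_add_sub_cancel]
      rw [Finset.sum_congr rfl fun p _ => h1 p, Finset.sum_add_distrib, ← Finset.mul_sum]
      have h2 : ∑ p ∈ b.support, F p = 0 := hsum
      have h3 : ∑ p ∈ b.support, (((p.1 - p₀.1) ⬝ᵥ u : ℤ) : L) * F p = 0 := hsum' u
      rw [h2, h3, mul_zero, add_zero]
  · push Not at hcase
    refine sum_ne_zero_of_forall_lt w (hA_supp a haA) haA (fun p _ hne => hlt p fun hp => ?_) hsum
    exact hne (Subtype.ext ((hcase p hp).trans (hcase a haA).symm))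

variable (e : Module.Basis (Fin n) ℤ (Fin n → ℤ)) {J : Set (Fin n)}

theorem dualVec_mem (j : Fin n) :
    dualVec e j ∈ dualMonoid (PointedCone.hull ℝ ((fun j => latticeToReal n (e j)) '' J)) :=
  (mem_dualMonoid_hull_iff e _ _).2 fun i _ => by
    rw [dualVec_dotProduct, e.repr_self, Finsupp.single_apply]
    split_ifs <;> simp

theorem neg_dualVec_mem {j : Fin n} (hj : j ∉ J) :
    -dualVec e j ∈ dualMonoid (PointedCone.hull ℝ ((fun j => latticeToReal n (e j)) '' J)) :=
  (mem_dualMonoid_hull_iff e _ _).2 fun i hi => by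
    rw [neg_dotProduct, dualVec_dotProduct, e.repr_self, Finsupp.single_apply,
      if_neg (by rintro rfl; exact hj hi), neg_zero]

theorem valuation_prod_pow {L ι : Type*} [Field L] (w : AddValuation L (WithTop ℝ)) {t : ι → L}
    {r : ι → ℝ} {s : Finset ι} (hr : ∀ j ∈ s, w (t j) = (r j : WithTop ℝ)) (k : ι → ℕ) :
    w (∏ j ∈ s, t j ^ k j) = ((∑ j ∈ s, k j * r j : ℝ) : WithTop ℝ) := by
  classical
  induction s using Finset.induction_on with
  | empty => simp
  | insert a s ha ih =>
    rw [Finset.prod_insert ha, Finset.sum_insert ha, w.map_mul, w.map_pow,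
      ih fun j hj => hr j (Finset.mem_insert_of_mem hj), hr a (Finset.mem_insert_self a s),
      ← WithTop.coe_nsmul, ← WithTop.coe_add, nsmul_eq_mul]

/-- In the coordinates `t j` of the point, `ν` weights each dual coordinate with `t j ≠ 0` by the
valuation of `t j`, and `h` adds up the coordinates with `t j = 0`. The latter indices lie in `J`,
so these coordinates are nonnegative on the monoid, and the monomial vanishes exactly when one of
them is positive. -/
theorem valuation_of_point {L : Type*} [Field L] [Algebra K L] (w : AddValuation L (WithTop ℝ))
    (x : ChartRing K (PointedCone.hull ℝ ((fun j => latticeToReal n (e j)) '' J)) →ₐ[K] L) :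
    ∃ ν h : (Fin n → ℝ) →ₗ[ℝ] ℝ, ∀ m : dualMonoid (PointedCone.hull ℝ
      ((fun j => latticeToReal n (e j)) '' J)),
      (x (AddMonoidAlgebra.single m 1) ≠ 0 →
        w (x (AddMonoidAlgebra.single m 1)) = (ν (latticeToReal n m.1) : WithTop ℝ) ∧
        h (latticeToReal n m.1) = 0) ∧
      (x (AddMonoidAlgebra.single m 1) = 0 → 0 < h (latticeToReal n m.1)) := by
  classical
  let σ := PointedCone.hull ℝ ((fun j => latticeToReal n (e j)) '' J)
  let X : Multiplicative (dualMonoid σ) →* L := (x : ChartRing K σ →* L).comp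
    (AddMonoidAlgebra.of K (dualMonoid σ))
  let t : Fin n → L := fun j => X (.ofAdd ⟨dualVec e j, dualVec_mem e j⟩)
  have ht : ∀ j ∉ J, t j ≠ 0 := by
    intro j hj h0
    have : t j * X (.ofAdd ⟨-dualVec e j, neg_dualVec_mem e hj⟩) = 1 := by
      rw [← map_mul, ← map_one X]
      congr 1
      refine Multiplicative.toAdd.injective (Subtype.ext ?_)
      exact add_neg_cancel (dualVec e j)
    rw [h0, zero_mul] at this
    exact zero_ne_one this
  let r : Fin n → ℝ := fun j => (w (t j)).untopD 0
  have hr : ∀ j, t j ≠ 0 → w (t j) = (r j : WithTop ℝ) := fun j hj => by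
    obtain ⟨s, hs⟩ := WithTop.ne_top_iff_exists.1 (w.ne_top_iff.2 hj)
    simp only [r, ← hs, WithTop.untopD_coe]
  let Z : Finset (Fin n) := Finset.univ.filter (t · = 0)
  let coord : Fin n → (Fin n → ℝ) →ₗ[ℝ] ℝ := fun j => pairing.flip (latticeToReal n (e j))
  have hcoord : ∀ j (m : Fin n → ℤ), coord j (latticeToReal n m) = ((m ⬝ᵥ e j : ℤ) : ℝ) :=
    fun j m => pairing_lattice m (e j)
  refine ⟨∑ j ∈ Finset.univ.filter (t · ≠ 0), r j • coord j, ∑ j ∈ Z, coord j, fun m => ?_⟩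
  have hpos : ∀ j ∈ Z, 0 ≤ m.1 ⬝ᵥ e j := fun j hj =>
    (mem_dualMonoid_hull_iff e _ _).1 m.2 j (by
      by_contra hJ
      exact ht j hJ (Finset.mem_filter.1 hj).2)
  -- Negative exponents are moved to the left side, so that only natural powers of the possibly
  -- vanishing `t j` occur.
  have key : X (.ofAdd m) * ∏ j, t j ^ (-(m.1 ⬝ᵥ e j)).toNat = ∏ j, t j ^ (m.1 ⬝ᵥ e j).toNat := by
    have hprod : ∀ k : Fin n → ℕ, ∏ j, t j ^ k j =
        X (.ofAdd (∑ j, k j • ⟨dualVec e j, dualVec_mem e j⟩)) := by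
      intro k
      rw [ofAdd_sum, map_prod]
      refine Finset.prod_congr rfl fun j _ => ?_
      rw [ofAdd_nsmul, map_pow]
    rw [hprod, hprod, ← map_mul]
    congr 1
    refine Multiplicative.toAdd.injective (Subtype.ext ?_)
    change m.1 + ((∑ j, (-(m.1 ⬝ᵥ e j)).toNat • ⟨dualVec e j, dualVec_mem e j⟩ : dualMonoid σ) :
      Fin n → ℤ) = ((∑ j, (m.1 ⬝ᵥ e j).toNat • ⟨dualVec e j, dualVec_mem e j⟩ : dualMonoid σ) :
      Fin n → ℤ)
    rw [AddSubmonoid.coe_finsetSum, AddSubmonoid.coe_finsetSum]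
    refine (congrArg (· + _) (sum_dotProduct_smul_dualVec e m.1).symm).trans ?_
    rw [← Finset.sum_add_distrib]
    refine Finset.sum_congr rfl fun j _ => ?_
    rw [AddSubmonoidClass.coe_nsmul, AddSubmonoidClass.coe_nsmul, ← natCast_zsmul, ← natCast_zsmul,
      ← add_smul]
    congr 1
    omega
  have hXm : X (.ofAdd m) = x (AddMonoidAlgebra.single m 1) := rfl
  rw [← hXm]
  have hsubset : ∀ k : Fin n → ℕ, (∀ j ∈ Z, k j = 0) →
      ∏ j, t j ^ k j = ∏ j ∈ Finset.univ.filter (t · ≠ 0), t j ^ k j := by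
    intro k hk
    refine (Finset.prod_subset (Finset.filter_subset _ _) fun j _ hj => ?_).symm
    rw [hk j (by simpa [Z] using hj), pow_zero]
  have hneg : ∀ j ∈ Z, (-(m.1 ⬝ᵥ e j)).toNat = 0 := fun j hj => by
    have := hpos j hj
    omega
  have hprod_ne : ∀ k : Fin n → ℕ, ∏ j ∈ Finset.univ.filter (t · ≠ 0), t j ^ k j ≠ 0 := fun k =>
    Finset.prod_ne_zero_iff.2 fun j hj => pow_ne_zero _ (Finset.mem_filter.1 hj).2
  rw [hsubset _ hneg] at key
  have hh : (∑ j ∈ Z, coord j) (latticeToReal n m.1) = ∑ j ∈ Z, ((m.1 ⬝ᵥ e j : ℤ) : ℝ) := by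
    rw [LinearMap.sum_apply]
    exact Finset.sum_congr rfl fun j _ => hcoord j m.1
  rw [hh]
  by_cases hZ : ∀ j ∈ Z, m.1 ⬝ᵥ e j = 0
  · rw [hsubset _ fun j hj => by rw [hZ j hj]; rfl] at key
    have hne : X (.ofAdd m) ≠ 0 := by
      intro h0
      rw [h0, zero_mul] at key
      exact hprod_ne _ key.symm
    refine ⟨fun _ => ⟨?_, Finset.sum_eq_zero fun j hj => by rw [hZ j hj, Int.cast_zero]⟩,
      fun h0 => absurd h0 hne⟩
    obtain ⟨s, hs⟩ := WithTop.ne_top_iff_exists.1 (w.ne_top_iff.2 hne)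
    have hw := congrArg w key
    have hr' : ∀ j ∈ Finset.univ.filter (t · ≠ 0), w (t j) = (r j : WithTop ℝ) := fun j hj =>
      hr j (Finset.mem_filter.1 hj).2
    rw [w.map_mul, valuation_prod_pow w hr', valuation_prod_pow w hr', ← hs, ← WithTop.coe_add,
      WithTop.coe_inj] at hw
    rw [← hs, WithTop.coe_inj, LinearMap.sum_apply, ← sub_eq_iff_eq_add.2 hw.symm,
      ← Finset.sum_sub_distrib]
    refine Finset.sum_congr rfl fun j _ => ?_
    rw [LinearMap.smul_apply, hcoord, smul_eq_mul, ← sub_mul, mul_comm]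
    congr 1
    have : (m.1 ⬝ᵥ e j : ℤ) = (m.1 ⬝ᵥ e j).toNat - (-(m.1 ⬝ᵥ e j)).toNat := by omega
    conv_rhs => rw [this]
    push_cast
    rfl
  · push Not at hZ
    obtain ⟨j, hj, hmj⟩ := hZ
    have hmj' : 0 < m.1 ⬝ᵥ e j := lt_of_le_of_ne (hpos j hj) hmj.symm
    have h0 : X (.ofAdd m) = 0 := by
      rw [Finset.prod_eq_zero (Finset.mem_univ j)] at key
      · exact (mul_eq_zero.1 key).resolve_right (hprod_ne _)
      · rw [(Finset.mem_filter.1 hj).2, zero_pow]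
        omega
    refine ⟨fun h => absurd h0 h, fun _ => ?_⟩
    exact Finset.sum_pos' (fun i hi => by exact_mod_cast hpos i hi) ⟨j, hj, by exact_mod_cast hmj'⟩

end Core

/-! ### Smoothness of the hypersurface in a chart -/

section Final

variable {K : Type u} [Field K] {n : ℕ} {Δ : Set (Fin n → ℝ)} (b : latticePoints Δ →₀ K)

theorem chartIdeal_eq_span {σ : PointedCone ℝ (Fin n → ℝ)} {m : Fin n → ℤ}
    (hm : m ∈ latticePoints Δ) (hσ : σ ≤ normalCone Δ (latticeToReal n m)) {f : ChartRing K σ}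
    (hf : chartIncl K σ f = AddMonoidAlgebra.single (-m) (1 : K) * laurent b) :
    chartIdeal b σ = Ideal.span {f} := by
  refine le_antisymm (Ideal.span_le.2 ?_)
    ((Ideal.span_singleton_le_iff_mem _).2 (Ideal.subset_span ⟨m, hm, hσ, hf⟩))
  rintro g ⟨m', hm', hσ', hg⟩
  have hmem : m - m' ∈ dualMonoid σ := fun u hu => by
    have : pairing (latticeToReal n m') u ≤ pairing (latticeToReal n m) u := hσ' hu _ hm
    rw [map_sub, map_sub, LinearMap.sub_apply]
    linarith
  refine Ideal.mem_span_singleton'.2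
    ⟨AddMonoidAlgebra.single (⟨m - m', hmem⟩ : dualMonoid σ) (1 : K), ?_⟩
  apply chartIncl_injective
  rw [map_mul, hf, chartIncl_single, chartIncl_apply, hg, ← mul_assoc,
    AddMonoidAlgebra.single_mul_single, one_mul]
  congr 2
  change m - m' + -m = -m'
  abel

theorem IsLatticePolytope.exists_latticePoint (hΔ : IsLatticePolytope Δ) {p : Fin n → ℝ}
    (hp : p ∈ Δ.extremePoints ℝ) : ∃ m ∈ latticePoints Δ, latticeToReal n m = p := by
  obtain ⟨V, -, hV⟩ := hΔ
  have h1 : p ∈ latticeToReal n '' (V : Set (Fin n → ℤ)) :=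
    extremePoints_convexHull_subset (𝕜 := ℝ) (hV ▸ hp)
  obtain ⟨m, -, rfl⟩ := h1
  exact ⟨m, hp.1, rfl⟩

theorem IsLatticePolytope.convex (hΔ : IsLatticePolytope Δ) : Convex ℝ Δ := by
  obtain ⟨V, -, rfl⟩ := hΔ
  exact convex_convexHull ℝ _

/-- A failure of the Jacobian criterion at a maximal ideal `𝔪` is a point over the residue field to
which `tropical_regularity` applies. The condition `b p₀ ≠ 0` ensures a non-zero term there, as the
monomial of `p₀` is `1`. -/
theorem smooth_chart_hypersurface (val : AddValuation K (WithTop ℝ))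
    (hval : ∀ m : ℤ, (m : K) ≠ 0 → val (m : K) = 0) (hΔ : Convex ℝ Δ)
    (hsub : InducesGoodSubdivision Δ (fun p => val (b p)) (ringChar K))
    (e : Module.Basis (Fin n) ℤ (Fin n → ℤ)) (J : Set (Fin n)) (p₀ : latticePoints Δ)
    (hb : b p₀ ≠ 0) (hσ : PointedCone.hull ℝ ((fun j => latticeToReal n (e j)) '' J) ≤
      normalCone Δ (latticeToReal n p₀.1)) :
    Algebra.Smooth K (ChartRing K (PointedCone.hull ℝ ((fun j => latticeToReal n (e j)) '' J)) ⧸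
      chartIdeal b (PointedCone.hull ℝ ((fun j => latticeToReal n (e j)) '' J))) := by
  have hsm := smooth_chartRing e K J
  revert hσ hsm
  generalize hσdef : PointedCone.hull ℝ ((fun j => latticeToReal n (e j)) '' J) = σ
  intro hσ hsm
  have hmem : ∀ p : latticePoints Δ, p.1 - p₀.1 ∈ dualMonoid σ := fun p u hu => by
    have : pairing (latticeToReal n p₀.1) u ≤ pairing (latticeToReal n p.1) u := hσ hu _ p.2
    rw [map_sub, map_sub, LinearMap.sub_apply]
    linarith
  let f : ChartRing K σ :=
    ∑ p ∈ b.support, AddMonoidAlgebra.single (⟨p.1 - p₀.1, hmem p⟩ : dualMonoid σ) (b p)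
  have hf : chartIncl K σ f = AddMonoidAlgebra.single (-p₀.1) (1 : K) * laurent b := by
    rw [laurent, Finsupp.sum, Finset.mul_sum, map_sum]
    refine Finset.sum_congr rfl fun p _ => ?_
    rw [chartIncl_single, AddMonoidAlgebra.single_mul_single, one_mul]
    congr 1
    exact sub_eq_neg_add _ _
  rw [chartIdeal_eq_span b p₀.2 hσ hf]
  suffices h : ∃ D : Derivation K (ChartRing K σ) (ChartRing K σ), D f - 1 ∈ Ideal.span {f} by
    obtain ⟨D, hD⟩ := h
    exact smooth_quotient_of_derivation f D hD
  refine exists_derivation_sub_one_mem fun 𝔪 h𝔪 hf𝔪 => ?_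
  by_contra! hcon
  let _ := Ideal.Quotient.field 𝔪
  have : Module.Finite K (ChartRing K σ ⧸ 𝔪) := finite_of_finite_type_of_isJacobsonRing K _
  obtain ⟨w, hw⟩ := exists_addValuation_extension (L := ChartRing K σ ⧸ 𝔪) val
  let x : ChartRing K σ →ₐ[K] ChartRing K σ ⧸ 𝔪 := Ideal.Quotient.mkₐ K 𝔪
  have hx : ∀ g ∈ 𝔪, x g = 0 := fun g hg => Ideal.Quotient.eq_zero_iff_mem.2 hg
  obtain ⟨ν, h, hνh⟩ : ∃ ν h : (Fin n → ℝ) →ₗ[ℝ] ℝ, ∀ m : dualMonoid σ,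
      (x (AddMonoidAlgebra.single m 1) ≠ 0 →
        w (x (AddMonoidAlgebra.single m 1)) = (ν (latticeToReal n m.1) : WithTop ℝ) ∧
        h (latticeToReal n m.1) = 0) ∧
      (x (AddMonoidAlgebra.single m 1) = 0 → 0 < h (latticeToReal n m.1)) := by
    subst hσdef
    exact valuation_of_point e w x
  let T : latticePoints Δ → ChartRing K σ ⧸ 𝔪 := fun p =>
    x (AddMonoidAlgebra.single (⟨p.1 - p₀.1, hmem p⟩ : dualMonoid σ) 1)
  have hxs : ∀ (p : latticePoints Δ) (c : K),
      x (AddMonoidAlgebra.single (⟨p.1 - p₀.1, hmem p⟩ : dualMonoid σ) c) =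
        algebraMap K _ c * T p := by
    intro p c
    rw [← Algebra.smul_def, ← map_smul, AddMonoidAlgebra.smul_single, smul_eq_mul, mul_one]
  refine tropical_regularity hval hw hΔ b hsub p₀ hb T ?_ ν h (fun p => (hνh _).1)
    (fun p => (hνh _).2) ?_ fun u => ?_
  · have : AddMonoidAlgebra.single (⟨p₀.1 - p₀.1, hmem p₀⟩ : dualMonoid σ) (1 : K) = 1 := by
      rw [AddMonoidAlgebra.one_def]
      congr 1
      exact Subtype.ext (sub_self p₀.1)
    simp only [T, this, map_one]
    exact one_ne_zero
  · have h1 := hx f hf𝔪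
    rw [map_sum] at h1
    rw [← h1]
    exact Finset.sum_congr rfl fun p _ => (hxs p _).symm
  -- The covector `u` defines the logarithmic derivation `z^m ↦ ⟨m, u⟩ z^m`; it maps `f` into `𝔪` as
  -- all derivations do.
  · let χ : dualMonoid σ →+ K :=
      { toFun := fun m => ((m.1 ⬝ᵥ u : ℤ) : K)
        map_zero' := by simp
        map_add' := fun m m' => by simp [add_dotProduct] }
    have h1 := hx _ (hcon (logDerivation χ))
    rw [map_sum, map_sum] at h1
    rw [← h1]
    refine Finset.sum_congr rfl fun p _ => ?_
    rw [logDerivation_single, hxs, map_mul, mul_assoc]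
    congr 1

end Final

end
end TropicalRegularity

theorem mainTheorem5 {K : Type u} [Field K] (val : AddValuation K (WithTop ℝ))
    (hval : ∀ m : ℤ, (m : K) ≠ 0 → val (m : K) = 0)
    (hK : IsAlgClosed K ∨ ∃ (k : Type u) (_ : Field k) (Q : AddSubgroup ℝ),
      Nonempty (K ≃+* TropicalRegularity.NovikovField k Q))
    {n : ℕ} (S : TropicalRegularity.Fan n) (hS : S.IsSmooth)
    (Δ : Set (Fin n → ℝ)) (hΔ : TropicalRegularity.IsLatticePolytope Δ)
    (hSΔ : S.IsSubordinate Δ)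
    (b : TropicalRegularity.latticePoints Δ →₀ K)
    (hfin : ∀ p : TropicalRegularity.latticePoints Δ,
      TropicalRegularity.latticeToReal n p.1 ∈ Δ.extremePoints ℝ → val (b p) ≠ ⊤)
    (hsub : TropicalRegularity.InducesGoodSubdivision Δ (fun p => val (b p)) (ringChar K)) :
    AlgebraicGeometry.Smooth (S.hypersurfaceStructureMap b) := by
  refine S.smooth_hypersurfaceStructureMap b (fun σ hσ => ?_) fun σ hσ => ?_
  · obtain ⟨p, hp, hle⟩ := hSΔ σ hσ
    obtain ⟨m, hm, rfl⟩ := hΔ.exists_latticePoint hp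
    exact ⟨m, hm, hle⟩
  · obtain ⟨p, hp, hle⟩ := hSΔ σ hσ
    obtain ⟨m, hm, rfl⟩ := hΔ.exists_latticePoint hp
    obtain ⟨e, J, rfl⟩ := hS σ hσ
    exact TropicalRegularity.smooth_chart_hypersurface b val hval hΔ.convex hsub e J ⟨m, hm⟩
      (val.ne_top_iff.1 (hfin ⟨m, hm⟩ hp)) hle
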